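/- Let $(X_k(t))_{1\le k\le \mathtt n(t)}$, $t\ge 0$, be a binary branching Brownian motion on $\mathbb R$: a single particle starts at the origin at time $0$; every particle performs a standard Brownian motion from its place of birth and, after an independent exponential lifetime of parameter one, splits into two particles which continue from the place of the split in the same way, all lifetimes and motions being independent. The particles alive at a given time are indistinguishable, i.e. numbered in a uniformly random order. For $n\ge 1$ and $t>0$ the measure $$A\mapsto \mathbb P\big(\{\mathtt n(t)=n\}\cap\{(X_1(t),\dots,X_n(t))\in A\}\big)$$ on $\mathbb R^n$ has a (unique) continuous nonnegative Lebesgue density $\rho_n(t,\cdot)$. Let $$c(t,x)=\sum_{n\ge 1} n\int_{\mathbb R^{n-1}}\rho_n(t,y_1,\dots,y_{n-1},x)\,dy_1\cdots dy_{n-1},\qquad t>0,\ x\in\mathbb R,$$ be the average concentration field (the integrals and the series converge). Then $c$ is a classical solution of $$\partial_t c(t,x)=\tfrac12\,\partial_x^2 c(t,x)+c(t,x),\qquad t>0,\ x\in\mathbb R,$$ with initial condition $c(0,\cdot)=\delta_0$, in the following sense. For $t\ge 0$ let $C_t(A)=\sum_{n\ge1} n\,\mathbb P(\{\mathtt n(t)=n\}\cap\{X_n(t)\in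 A\})$ be the average concentration measure. Then $C_t(dx)=c(t,x)\,dx$ for $t>0$, $C_0=\delta_0$, each $c(t,\cdot)$ with $t>0$ is integrable, and $\int_{\mathbb R} f(x)\,c(t,x)\,dx\to f(0)$ as $t\downarrow 0$ for every bounded continuous $f:\mathbb R\to\mathbb R$. -/

import Mathlib

open MeasureTheory ProbabilityTheory Filter Topology
open scoped NNReal ENNReal Nat BoundedContinuousFunction

namespace BBM

noncomputable section

/-- The driving randomness of a binary branching Brownian motion on the line, started from one
particle at the origin. Particles are labelled by the nodes `u : List Bool` of the infinite binary
tree: `[]` is the initial particle, and the two offspring of `u` are `u ++ [false]` and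
`u ++ [true]`. Particle `u` lives for an exponential time `τ u` of parameter one and its displacement
from its place of birth is the standard Brownian motion `B u`; all these lifetimes and motions are
independent. -/
structure IsBranchingBrownianMotion {Ω : Type*} [MeasurableSpace Ω] (P : Measure Ω)
    (τ : List Bool → Ω → ℝ) (B : List Bool → ℝ≥0 → Ω → ℝ) : Prop where
  measurable_lifetime : ∀ u, Measurable (τ u)
  measurable_motion : ∀ u s, Measurable (B u s)
  lifetime_law : ∀ u, HasLaw (τ u) (expMeasure 1) P
  brownian : ∀ u, IsBrownianReal (B u) P
  indep_lifetime_motion : ∀ u, IndepFun (τ u) (fun ω s => B u s ω) P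
  indep_particles : iIndepFun (fun u ω => (τ u ω, fun s => B u s ω)) P

variable {Ω : Type*}

/-- The time of birth of particle `u`: the sum of the lifetimes of its strict ancestors, which are
the proper prefixes of `u`. -/
def birth (τ : List Bool → Ω → ℝ) (u : List Bool) (ω : Ω) : ℝ :=
  ∑ k ∈ Finset.range u.length, τ (u.take k) ω

/-- The set of the particles that are alive at time `t`. -/
def alive (τ : List Bool → Ω → ℝ) (t : ℝ) (ω : Ω) : Set (List Bool) :=
  {u | birth τ u ω ≤ t ∧ t < birth τ u ω + τ u ω}

/-- The place of particle `u` at a time `t` at which it is alive: the sum of the displacements of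
its strict ancestors over their whole lives, plus its own displacement since its birth. -/
def position (τ : List Bool → Ω → ℝ) (B : List Bool → ℝ≥0 → Ω → ℝ) (u : List Bool) (t : ℝ)
    (ω : Ω) : ℝ :=
  ∑ k ∈ Finset.range u.length, B (u.take k) (τ (u.take k) ω).toNNReal ω
    + B u (t - birth τ u ω).toNNReal ω

variable [MeasurableSpace Ω]

/-- The sub-probability measure
`A ↦ ℙ ({there are n particles at time t} ∩ {(X₁(t), …, Xₙ(t)) ∈ A})` on `ℝⁿ`, where the `n`
particles are indistinguishable, i.e. numbered uniformly at random: every injective `e` enumerates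
the particles alive with weight `1 / n!` on the event that they are `e 0, …, e (n - 1)`. -/
def particleLaw (P : Measure Ω) (τ : List Bool → Ω → ℝ) (B : List Bool → ℝ≥0 → Ω → ℝ)
    (n : ℕ) (t : ℝ) : Measure (Fin n → ℝ) :=
  (n ! : ℝ≥0∞)⁻¹ • Measure.sum fun e : Fin n ↪ List Bool =>
    (P.restrict {ω | alive τ t ω = Set.range e}).map (fun ω i => position τ B (e i) t ω)

/-- `ρ n t` is, for `n ≥ 1` and `t > 0`, the continuous Lebesgue density on `ℝⁿ` of the law of the
particles on the event that there are exactly `n` of them at time `t`. (Continuity fixes the values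
of the density at every point.) -/
structure IsParticleDensity (P : Measure Ω) (τ : List Bool → Ω → ℝ)
    (B : List Bool → ℝ≥0 → Ω → ℝ) (ρ : (n : ℕ) → ℝ → (Fin n → ℝ) → ℝ) : Prop where
  nonneg : ∀ n t, 1 ≤ n → 0 < t → ∀ y, 0 ≤ ρ n t y
  continuous : ∀ n t, 1 ≤ n → 0 < t → Continuous (ρ n t)
  law_eq : ∀ n t, 1 ≤ n → 0 < t →
    particleLaw P τ B n t = volume.withDensity (fun y => ENNReal.ofReal (ρ n t y))

/-- The integral `∫ ρₙ₊₁(t, y₁, …, yₙ, x) dy₁ … dyₙ`. -/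
def lastMarginal (ρ : (n : ℕ) → ℝ → (Fin n → ℝ) → ℝ) (n : ℕ) (t x : ℝ) : ℝ :=
  ∫ y : Fin n → ℝ, ρ (n + 1) t (Fin.snoc (α := fun _ => ℝ) y x)

/-- The average concentration field
`c(t, x) = ∑_{n ≥ 1} n ∫ ρₙ(t, y₁, …, yₙ₋₁, x) dy₁ … dyₙ₋₁`
(the index of summation is shifted by one). -/
def averageConcentration (ρ : (n : ℕ) → ℝ → (Fin n → ℝ) → ℝ) (t x : ℝ) : ℝ :=
  ∑' n : ℕ, ((n : ℝ) + 1) * lastMarginal ρ n t x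

/-- The average concentration at time `t` as a measure on the line, which makes sense also at time
`0`, when there are no densities:
`A ↦ ∑_{n ≥ 1} n ℙ ({there are n particles at time t} ∩ {Xₙ(t) ∈ A})`. -/
def concentrationMeasure (P : Measure Ω) (τ : List Bool → Ω → ℝ) (B : List Bool → ℝ≥0 → Ω → ℝ)
    (t : ℝ) : Measure ℝ :=
  Measure.sum fun n : ℕ =>
    ((n : ℝ≥0∞) + 1) • (particleLaw P τ B (n + 1) t).map (fun y => y (Fin.last n))

end

end BBM

/-! The proof is a many-to-one computation giving the closed form `c(t, x) = exp t * heatR t x`,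
after which every claim is a fact about the Gaussian kernel. Two things are behind the formula. The
genealogy is decided by the lifetimes alone, and the motion along any one line of descent is
Brownian, so given the genealogy each particle alive at time `t` is Gaussian with variance `t`
(`lintegral_density_mul_coord`). And the mean population size is `exp t`: a word of length `k` is
alive with the Poisson probability `exp (-t) * t ^ k / k!`, and there are `2 ^ k` such words
(`Regular.tsum_measure_mem_alive`). So the last marginal of `ρ n` is the mass of `{n(t) = n}` times
the heat kernel, and summing these masses with weight `n` gives `exp t`.

The work lies in having this at every point `x`, not just almost everywhere. To that end the law of
the particles is split according to the finite binary tree formed by the population. For each tree a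
density is defined by recursion at the first split, and the branching property identifies it with
the law of the positions (`Regular.setLIntegral_positions_eq`). By induction it is at most a
constant times the heat kernel of each single coordinate (`exists_density_le`). The induction closes
because the maximum of the heat kernel at time `r` is of order `r ^ (-1/2)`, which is integrable at
`0`. This domination gives continuity of the densities (`continuous_density`) and of their marginals
(`IsHeatBounded.lintegral_snoc_eq`), so that almost everywhere identities hold everywhere.

The population is almost surely finite (`Regular.ae_exists_alive_eq`), so only finitely many
enumerations matter for each `n`. Finally, a branching Brownian motion is replaced by an almost
surely equal one that is regular for every sample. -/

namespace BBM

noncomputable section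

/-! ### The heat kernel: Chapman–Kolmogorov and the size of its maximum. -/

/-- The heat kernel of `∂ₜ = ½ ∂ₓ²` on the line. -/
def heatR (t x : ℝ) : ℝ := (√(2 * Real.pi * t))⁻¹ * Real.exp (-x ^ 2 / (2 * t))

/-- The heat kernel as an extended nonnegative function. -/
def heat (t x : ℝ) : ℝ≥0∞ := ENNReal.ofReal (heatR t x)

lemma heatR_nonneg (t x : ℝ) : 0 ≤ heatR t x := by unfold heatR; positivity

lemma heatR_eq_gaussianPDFReal {t : ℝ} (ht : 0 ≤ t) (x : ℝ) :
    heatR t x = gaussianPDFReal 0 t.toNNReal x := by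
  simp [heatR, gaussianPDFReal, ht]

lemma heat_eq_gaussianPDF {t : ℝ} (ht : 0 ≤ t) (x : ℝ) :
    heat t x = gaussianPDF 0 t.toNNReal x := by
  simp [heat, gaussianPDF, heatR_eq_gaussianPDFReal ht]

lemma gaussianReal_eq_withDensity_heat {t : ℝ} (ht : 0 < t) :
    gaussianReal 0 t.toNNReal = volume.withDensity (heat t) := by
  rw [gaussianReal_of_var_ne_zero _ (by simpa using ht)]
  congr 1
  ext x
  rw [heat_eq_gaussianPDF ht.le]

lemma measurable_heatR : Measurable (fun p : ℝ × ℝ => heatR p.1 p.2) := by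
  unfold heatR; fun_prop

lemma measurable_heat : Measurable (fun p : ℝ × ℝ => heat p.1 p.2) :=
  measurable_heatR.ennreal_ofReal

@[fun_prop]
lemma measurable_heat_comp {α : Type*} [MeasurableSpace α] {f g : α → ℝ} (hf : Measurable f)
    (hg : Measurable g) : Measurable (fun a => heat (f a) (g a)) :=
  measurable_heat.comp (hf.prodMk hg)

lemma continuous_heatR (t : ℝ) : Continuous (heatR t) := by
  unfold heatR; fun_prop

lemma continuous_heat (t : ℝ) : Continuous (heat t) :=
  ENNReal.continuous_ofReal.comp (continuous_heatR t)

lemma heat_ne_top (t x : ℝ) : heat t x ≠ ∞ := ENNReal.ofReal_ne_top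

lemma lintegral_heat {t : ℝ} (ht : 0 < t) : ∫⁻ x, heat t x = 1 := by
  simp_rw [heat_eq_gaussianPDF ht.le]
  exact lintegral_gaussianPDF_eq_one 0 (by simpa using ht)

/-- The maximum of the heat kernel. -/
def heatMax (t : ℝ) : ℝ≥0∞ := ENNReal.ofReal (√(2 * Real.pi * t))⁻¹

@[fun_prop]
lemma measurable_heatMax : Measurable heatMax := by
  unfold heatMax; fun_prop

lemma heatMax_ne_top (t : ℝ) : heatMax t ≠ ∞ := ENNReal.ofReal_ne_top

lemma heat_le_heatMax {t : ℝ} (ht : 0 < t) (x : ℝ) : heat t x ≤ heatMax t := by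
  refine ENNReal.ofReal_le_ofReal ?_
  have : Real.exp (-x ^ 2 / (2 * t)) ≤ 1 := by
    rw [Real.exp_le_one_iff]
    exact div_nonpos_of_nonpos_of_nonneg (by nlinarith [sq_nonneg x]) (by positivity)
  exact mul_le_of_le_one_right (by positivity) this

/-- Completing the square in `z`. The last factor is the density at time `s` of a Brownian bridge
from `0` to `x` of length `s + r`. -/
lemma heatR_mul_heatR {s r : ℝ} (hs : 0 < s) (hr : 0 < r) (x z : ℝ) :
    heatR s z * heatR r (x - z) =
      heatR (s + r) x * heatR (s * r / (s + r)) (z - s * x / (s + r)) := by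
  have h : 0 < s + r := by positivity
  unfold heatR
  rw [mul_mul_mul_comm, mul_mul_mul_comm _ (Real.exp (-x ^ 2 / _)), ← Real.exp_add,
    ← Real.exp_add, ← mul_inv, ← mul_inv, ← Real.sqrt_mul (by positivity), ← Real.sqrt_mul (by positivity)]
  congr 2
  · congr 1
    field_simp
  · field_simp
    ring

lemma lintegral_heat_mul_heat {s r : ℝ} (hs : 0 < s) (hr : 0 < r) (x : ℝ) :
    ∫⁻ z, heat s z * heat r (x - z) = heat (s + r) x := by
  simp_rw [heat, ← ENNReal.ofReal_mul (heatR_nonneg _ _), heatR_mul_heatR hs hr,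
    ENNReal.ofReal_mul (heatR_nonneg _ _)]
  rw [lintegral_const_mul' _ _ ENNReal.ofReal_ne_top]
  have := lintegral_sub_right_eq_self (μ := volume) (heat (s * r / (s + r))) (s * x / (s + r))
  simp only [heat] at this
  rw [this]
  have h2 := lintegral_heat (t := s * r / (s + r)) (by positivity)
  simp only [heat] at h2
  rw [h2, mul_one]

/-- The singularity at `0` is `r ^ (-1/2)`, which is integrable. This keeps the constants of
`exists_density_le` finite. -/
lemma lintegral_heatMax_Ioo (t : ℝ) : ∫⁻ r in Set.Ioo 0 t, heatMax r < ∞ := by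
  have h : IntegrableOn (fun r : ℝ => (√(2 * Real.pi * r))⁻¹) (Set.Ioo 0 t) := by
    rcases le_or_gt t 0 with ht | ht
    · simp [Set.Ioo_eq_empty_of_le ht]
    have h1 := (intervalIntegral.intervalIntegrable_rpow' (a := 0) (b := t) (r := -(1 / 2))
      (by norm_num)).const_mul (√(2 * Real.pi))⁻¹
    rw [intervalIntegrable_iff_integrableOn_Ioo_of_le ht.le] at h1
    refine h1.congr_fun (fun r hr => ?_) measurableSet_Ioo
    simp only
    rw [Real.sqrt_mul (by positivity) r, mul_inv, Real.rpow_neg hr.1.le, ← Real.sqrt_eq_rpow]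
  exact h.lintegral_lt_top

/-! ### The heat equation and convergence to the Dirac mass. -/

section Equation

lemma hasDerivAt_heatR_space {t : ℝ} (ht : 0 < t) (x : ℝ) :
    HasDerivAt (heatR t) (-(x / t) * heatR t x) x := by
  have h : HasDerivAt (fun x : ℝ => -x ^ 2 / (2 * t)) (-(x / t)) x := by
    have := ((hasDerivAt_pow 2 x).neg).div_const (2 * t)
    refine this.congr_deriv ?_
    norm_num
    field_simp
  refine ((h.exp).const_mul (√(2 * Real.pi * t))⁻¹).congr_deriv ?_
  simp only [heatR]
  ring

lemma deriv_heatR_space {t : ℝ} (ht : 0 < t) :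
    deriv (heatR t) = fun x => -(x / t) * heatR t x :=
  funext fun x => (hasDerivAt_heatR_space ht x).deriv

lemma iteratedDeriv_two_heatR {t : ℝ} (ht : 0 < t) (x : ℝ) :
    iteratedDeriv 2 (heatR t) x = (x ^ 2 / t ^ 2 - 1 / t) * heatR t x := by
  rw [iteratedDeriv_succ, iteratedDeriv_one, deriv_heatR_space ht]
  have h1 : HasDerivAt (fun x : ℝ => -(x / t)) (-(1 / t)) x :=
    ((hasDerivAt_id x).div_const t).neg
  rw [(h1.fun_mul (hasDerivAt_heatR_space ht x)).deriv]
  field_simp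
  ring

lemma contDiff_heatR (t : ℝ) : ContDiff ℝ 2 (heatR t) := by
  unfold heatR
  fun_prop

lemma hasDerivAt_heatR_time {t : ℝ} (ht : 0 < t) (x : ℝ) :
    HasDerivAt (fun s => heatR s x) (1 / 2 * ((x ^ 2 / t ^ 2 - 1 / t) * heatR t x)) t := by
  have h2 : HasDerivAt (fun s : ℝ => 2 * Real.pi * s) (2 * Real.pi) t := by
    simpa using (hasDerivAt_id t).const_mul (2 * Real.pi)
  have h1 := (h2.sqrt (by positivity)).inv (by positivity)
  have h3 : HasDerivAt (fun s : ℝ => 2 * s) 2 t := by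
    simpa using (hasDerivAt_id t).const_mul 2
  have h4 := ((h3.inv (by positivity)).const_mul (-x ^ 2)).exp
  have h5 := h1.mul h4
  have hs : √(2 * Real.pi * t) ^ 2 = 2 * Real.pi * t := Real.sq_sqrt (by positivity)
  refine (h5.congr_deriv ?_).congr_of_eventuallyEq ?_
  · simp only [Pi.inv_apply, heatR]
    rw [hs]
    have : 0 < √(2 * Real.pi * t) := by positivity
    rw [div_eq_mul_inv (-x ^ 2)]
    field_simp
    ring
  · exact Eventually.of_forall fun s => by simp [heatR, div_eq_mul_inv]

lemma continuousOn_heatR :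
    ContinuousOn (fun z : ℝ × ℝ => heatR z.1 z.2) (Set.Ioi 0 ×ˢ Set.univ) := by
  unfold heatR
  refine ContinuousOn.mul (ContinuousOn.inv₀ (by fun_prop) ?_)
    (Real.continuous_exp.comp_continuousOn (ContinuousOn.div (by fun_prop) (by fun_prop) ?_))
  · rintro z hz
    have : 0 < z.1 := hz.1
    positivity
  · rintro z hz
    have : 0 < z.1 := hz.1
    positivity

lemma integrable_heatR {t : ℝ} (ht : 0 < t) : Integrable (heatR t) := by
  have := integrable_gaussianPDFReal 0 t.toNNReal
  refine this.congr (Eventually.of_forall fun x => ?_)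
  rw [heatR_eq_gaussianPDFReal ht.le]

/-- Brownian scaling moves the dependence on `t` from the kernel to the test function, so that
dominated convergence applies as `t` tends to `0`. -/
lemma integral_mul_heatR {t : ℝ} (ht : 0 < t) (f : ℝ → ℝ) :
    ∫ x, f x * heatR t x = ∫ y, f (√t * y) * heatR 1 y := by
  have hs : 0 < √t := by positivity
  have h := Measure.integral_comp_mul_left (fun x => f x * heatR t x) (√t)
  rw [abs_of_pos (by positivity), smul_eq_mul, eq_comm, inv_mul_eq_iff_eq_mul₀ hs.ne',
    ← integral_const_mul] at h
  rw [h]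
  congr 1
  ext y
  have : √t * heatR t (√t * y) = heatR 1 y := by
    unfold heatR
    rw [mul_pow, Real.sq_sqrt ht.le, Real.sqrt_mul (by positivity), mul_one, mul_inv]
    field_simp
  rw [← this]
  ring

lemma integral_heatR {t : ℝ} (ht : 0 < t) : ∫ x, heatR t x = 1 := by
  simp_rw [heatR_eq_gaussianPDFReal ht.le]
  exact integral_gaussianPDFReal_eq_one 0 (by simpa using ht)

lemma tendsto_integral_mul_heatR (f : ℝ →ᵇ ℝ) :
    Tendsto (fun t : ℝ => ∫ x, f x * heatR t x) (𝓝[>] 0) (𝓝 (f 0)) := by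
  have h : Tendsto (fun t : ℝ => ∫ y, f (√t * y) * heatR 1 y) (𝓝[>] 0)
      (𝓝 (∫ y, f 0 * heatR 1 y)) := by
    refine tendsto_integral_filter_of_dominated_convergence (fun y => ‖f‖ * heatR 1 y) ?_ ?_ ?_ ?_
    · refine Eventually.of_forall fun t => Continuous.aestronglyMeasurable ?_
      have := continuous_heatR 1
      fun_prop
    · refine Eventually.of_forall fun t => Eventually.of_forall fun y => ?_
      rw [norm_mul, Real.norm_of_nonneg (heatR_nonneg _ _)]
      exact mul_le_mul_of_nonneg_right (f.norm_coe_le_norm _) (heatR_nonneg _ _)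
    · exact (integrable_heatR one_pos).const_mul _
    · refine Eventually.of_forall fun y => ?_
      have hc : Continuous (fun t : ℝ => f (√t * y) * heatR 1 y) := by fun_prop
      have := (hc.tendsto 0).mono_left (nhdsWithin_le_nhds (s := Set.Ioi 0))
      simpa using this
  rw [integral_const_mul, integral_heatR one_pos, mul_one] at h
  refine h.congr' ?_
  filter_upwards [self_mem_nhdsWithin] with t ht
  exact (integral_mul_heatR ht f).symm

end Equation

/-! ### Integration against the exponential law. -/

section Exponential

lemma expMeasure_one_eq :
    expMeasure 1 = volume.withDensity (fun s : ℝ => exponentialPDF 1 s) := rfl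

instance : IsProbabilityMeasure (expMeasure 1) := isProbabilityMeasure_expMeasure one_pos

lemma measurable_exponentialPDF_one : Measurable (fun s : ℝ => exponentialPDF 1 s) := by
  unfold exponentialPDF; fun_prop

lemma setLIntegral_expMeasure {A : Set ℝ} (hA : MeasurableSet A) {f : ℝ → ℝ≥0∞}
    (hf : Measurable f) :
    ∫⁻ s in A, f s ∂(expMeasure 1) =
      ∫⁻ s in A ∩ Set.Ioi 0, ENNReal.ofReal (Real.exp (-s)) * f s := by
  rw [expMeasure_one_eq, setLIntegral_withDensity_eq_setLIntegral_mul _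
    measurable_exponentialPDF_one hf hA, ← lintegral_indicator hA,
    ← lintegral_indicator (hA.inter measurableSet_Ioi)]
  refine lintegral_congr_ae ?_
  -- The exponential density is nonzero at `0`, which the open half-line omits; this point is
  -- negligible.
  filter_upwards [compl_mem_ae_iff.2 (measure_singleton (0 : ℝ))] with s hs
  have hs0 : s ≠ 0 := hs
  by_cases hsA : s ∈ A
  · rcases lt_or_gt_of_ne hs0 with h | h
    · simp [Set.indicator, hsA, h.not_gt, exponentialPDF_of_neg h]
    · simp [Set.indicator, hsA, h, exponentialPDF_of_nonneg h.le]
  · simp [Set.indicator, hsA]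

lemma ae_pos_expMeasure : ∀ᵐ s ∂(expMeasure 1), 0 < s := by
  rw [ae_iff]
  have h : MeasurableSet {s : ℝ | ¬ 0 < s} :=
    (measurableSet_lt measurable_const measurable_id).compl
  rw [← setLIntegral_one, setLIntegral_expMeasure h measurable_const]
  have : {s : ℝ | ¬ 0 < s} ∩ Set.Ioi 0 = ∅ := by ext; simp
  rw [this]; simp

lemma expMeasure_absolutelyContinuous : expMeasure 1 ≪ volume :=
  withDensity_absolutelyContinuous _ _

lemma setLIntegral_expMeasure_Iio (t : ℝ) {f : ℝ → ℝ≥0∞} (hf : Measurable f) :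
    ∫⁻ s in Set.Iio t, f s ∂(expMeasure 1) =
      ∫⁻ s in Set.Ioo 0 t, ENNReal.ofReal (Real.exp (-s)) * f s := by
  rw [setLIntegral_expMeasure measurableSet_Iio hf, Set.inter_comm, Set.Ioi_inter_Iio]

lemma setLIntegral_expMeasure_Iio_le (t : ℝ) {f : ℝ → ℝ≥0∞} (hf : Measurable f) :
    ∫⁻ s in Set.Iio t, f s ∂(expMeasure 1) ≤ ∫⁻ s in Set.Ioo 0 t, f s := by
  rw [setLIntegral_expMeasure_Iio t hf]
  refine setLIntegral_mono' measurableSet_Ioo fun s hs => ?_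
  refine mul_le_of_le_one_left (zero_le) ?_
  rw [ENNReal.ofReal_le_one, Real.exp_le_one_iff]
  linarith [hs.1]

lemma setLIntegral_Ioo_comp_sub (t : ℝ) (f : ℝ → ℝ≥0∞) :
    ∫⁻ s in Set.Ioo 0 t, f (t - s) = ∫⁻ s in Set.Ioo 0 t, f s := by
  rw [← lintegral_indicator measurableSet_Ioo, ← lintegral_indicator measurableSet_Ioo,
    ← lintegral_sub_left_eq_self _ t]
  congr 1
  ext s
  simp only [Set.indicator, Set.mem_Ioo]
  simp only [sub_sub_cancel]
  congr 1
  simp [and_comm]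

lemma setLIntegral_expMeasure_heatMax_le {t t₀ : ℝ} (h : t ≤ t₀) :
    ∫⁻ s in Set.Iio t, heatMax (t - s) ∂(expMeasure 1) ≤ ∫⁻ r in Set.Ioo 0 t₀, heatMax r := by
  refine (setLIntegral_expMeasure_Iio_le t (by fun_prop)).trans ?_
  rw [setLIntegral_Ioo_comp_sub t heatMax]
  exact lintegral_mono_set (Set.Ioo_subset_Ioo_right h)

end Exponential

/-! ### Genealogies: recursive densities, Gaussian domination and continuity. -/

/-- Finite full binary trees: the possible genealogies of the population at a given time. -/
inductive Genealogy
  | leaf : Genealogy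
  | node : Genealogy → Genealogy → Genealogy

namespace Genealogy

/-- The leaves of a genealogy, i.e. the particles alive. -/
@[reducible]
def Leaf : Genealogy → Type
  | leaf => Unit
  | node l r => Leaf l ⊕ Leaf r

instance instFintypeLeaf : (T : Genealogy) → Fintype (Leaf T)
  | leaf => inferInstanceAs (Fintype Unit)
  | node l r =>
    haveI := instFintypeLeaf l
    haveI := instFintypeLeaf r
    inferInstanceAs (Fintype (Leaf l ⊕ Leaf r))

instance instNonemptyLeaf : (T : Genealogy) → Nonempty (Leaf T)
  | leaf => inferInstanceAs (Nonempty Unit)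
  | node l _ => (instNonemptyLeaf l).map Sum.inl

/-- The label of a leaf in the infinite binary tree. -/
def label : (T : Genealogy) → Leaf T → List Bool
  | leaf, _ => []
  | node l _, Sum.inl i => false :: label l i
  | node _ r, Sum.inr i => true :: label r i

lemma label_injective : (T : Genealogy) → Function.Injective (label T)
  | leaf => fun _ _ _ => rfl
  | node l r => by
    rintro (i | i) (j | j) h <;> simp only [label, List.cons.injEq, reduceCtorEq, false_and,
      true_and] at h
    · exact congrArg _ (label_injective l h)
    · exact congrArg _ (label_injective r h)

/-- The densities of the subtrees `f`, `g` of a node are combined by integrating over the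
displacement of the particle at the node, which splits at time `s`. -/
def displaced {α β : Type} (f : ℝ → (α → ℝ) → ℝ≥0∞) (g : ℝ → (β → ℝ) → ℝ≥0∞) (t s : ℝ)
    (x : α ⊕ β → ℝ) : ℝ≥0∞ :=
  ∫⁻ z, heat s z * (f (t - s) (fun i => x (Sum.inl i) - z) * g (t - s) (fun i => x (Sum.inr i) - z))

/-- The density at time `t` of the positions of the leaves on the event that the genealogy of the
population is `T`. -/
def density : (T : Genealogy) → ℝ → (Leaf T → ℝ) → ℝ≥0∞
  | leaf, t, x => ENNReal.ofReal (Real.exp (-t)) * heat t (x ())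
  | node l r, t, x => ∫⁻ s in Set.Iio t, displaced (density l) (density r) t s x ∂(expMeasure 1)

section Measurability

variable {α β : Type} {f : ℝ → (α → ℝ) → ℝ≥0∞} {g : ℝ → (β → ℝ) → ℝ≥0∞}

lemma measurable_displaced_integrand (hf : Measurable (fun p : ℝ × (α → ℝ) => f p.1 p.2))
    (hg : Measurable (fun p : ℝ × (β → ℝ) => g p.1 p.2)) :
    Measurable (fun p : ((ℝ × ℝ) × (α ⊕ β → ℝ)) × ℝ => heat p.1.1.2 p.2 *
      (f (p.1.1.1 - p.1.1.2) (fun i => p.1.2 (Sum.inl i) - p.2) *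
        g (p.1.1.1 - p.1.1.2) (fun i => p.1.2 (Sum.inr i) - p.2))) := by
  have h1 : Measurable (fun p : ((ℝ × ℝ) × (α ⊕ β → ℝ)) × ℝ =>
      (p.1.1.1 - p.1.1.2, fun i : α => p.1.2 (Sum.inl i) - p.2)) := by fun_prop
  have h2 : Measurable (fun p : ((ℝ × ℝ) × (α ⊕ β → ℝ)) × ℝ =>
      (p.1.1.1 - p.1.1.2, fun i : β => p.1.2 (Sum.inr i) - p.2)) := by fun_prop
  exact (measurable_heat_comp (by fun_prop) (by fun_prop)).mul ((hf.comp h1).mul (hg.comp h2))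

lemma measurable_displaced (hf : Measurable (fun p : ℝ × (α → ℝ) => f p.1 p.2))
    (hg : Measurable (fun p : ℝ × (β → ℝ) => g p.1 p.2)) :
    Measurable (fun p : (ℝ × ℝ) × (α ⊕ β → ℝ) => displaced f g p.1.1 p.1.2 p.2) :=
  (measurable_displaced_integrand hf hg).lintegral_prod_right'

end Measurability

lemma measurable_density : (T : Genealogy) →
    Measurable (fun p : ℝ × (Leaf T → ℝ) => density T p.1 p.2)
  | leaf => by
    simp only [density]
    refine Measurable.mul (by fun_prop) (measurable_heat_comp (by fun_prop) (by fun_prop))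
  | node l r => by
    have h := measurable_displaced (measurable_density l) (measurable_density r)
    -- The domain `s < t` varies with `t`, so it is absorbed into a jointly measurable indicator
    -- before integrating.
    have h2 : Measurable (fun p : (ℝ × (Leaf (node l r) → ℝ)) × ℝ =>
        {q : (ℝ × (Leaf (node l r) → ℝ)) × ℝ | q.2 < q.1.1}.indicator
          (fun q => displaced (density l) (density r) q.1.1 q.2 q.1.2) p) := by
      refine Measurable.indicator ?_ (measurableSet_lt (by fun_prop) (by fun_prop))
      exact h.comp (f := fun p : (ℝ × (Leaf (node l r) → ℝ)) × ℝ => ((p.1.1, p.2), p.1.2))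
        (by fun_prop)
    have h3 := h2.lintegral_prod_right' (ν := expMeasure 1)
    convert h3 using 2 with p
    simp only [density]
    rw [← lintegral_indicator measurableSet_Iio]
    rfl

lemma measurable_density_right (T : Genealogy) (t : ℝ) : Measurable (density T t) :=
  (measurable_density T).comp measurable_prodMk_left

lemma measurable_displaced_split (l r : Genealogy) (t : ℝ) (x : Leaf (node l r) → ℝ) :
    Measurable (fun s => displaced (density l) (density r) t s x) :=
  (measurable_displaced (measurable_density l) (measurable_density r)).comp
    (f := fun s : ℝ => ((t, s), x)) (by fun_prop)

section Bound

variable {α β : Type} {f : ℝ → (α → ℝ) → ℝ≥0∞} {g : ℝ → (β → ℝ) → ℝ≥0∞} {t s : ℝ} {C D : ℝ≥0∞}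

/-- The factor containing coordinate `i` keeps its Gaussian bound, the other one is replaced by its
supremum, and Chapman–Kolmogorov integrates out the displacement. The coordinate `j` only serves to
bound the second factor, so a single power of `heatMax` is lost. -/
lemma displaced_le_inl (h0 : 0 < s) (hst : s < t) (j : β)
    (hf : ∀ x i, f (t - s) x ≤ C * heat (t - s) (x i))
    (hg : ∀ x i, g (t - s) x ≤ D * heat (t - s) (x i)) (x : α ⊕ β → ℝ) (i : α) :
    displaced f g t s x ≤ C * D * heatMax (t - s) * heat t (x (Sum.inl i)) := by
  have ht : 0 < t - s := sub_pos.2 hst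
  calc displaced f g t s x
      ≤ ∫⁻ z, (C * D * heatMax (t - s)) * (heat s z * heat (t - s) (x (Sum.inl i) - z)) := by
        refine lintegral_mono fun z => ?_
        calc _ ≤ heat s z * ((C * heat (t - s) (x (Sum.inl i) - z)) * (D * heatMax (t - s))) := by
              gcongr
              · exact hf _ i
              · exact (hg _ j).trans (by gcongr; exact heat_le_heatMax ht _)
          _ = _ := by ring
    _ = _ := by
        have hm : Measurable fun z => heat s z * heat (t - s) (x (Sum.inl i) - z) :=
          (measurable_heat_comp (by fun_prop) (by fun_prop)).mul
            (measurable_heat_comp (by fun_prop) (by fun_prop))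
        rw [lintegral_const_mul _ hm, lintegral_heat_mul_heat h0 ht]
        congr 2
        ring

lemma displaced_swap (x : α ⊕ β → ℝ) :
    displaced f g t s x = displaced g f t s (x ∘ Sum.swap) := by
  unfold displaced
  simp [mul_comm]

lemma displaced_le (h0 : 0 < s) (hst : s < t) [Nonempty α] [Nonempty β]
    (hf : ∀ x i, f (t - s) x ≤ C * heat (t - s) (x i))
    (hg : ∀ x i, g (t - s) x ≤ D * heat (t - s) (x i)) (x : α ⊕ β → ℝ) (i : α ⊕ β) :
    displaced f g t s x ≤ C * D * heatMax (t - s) * heat t (x i) := by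
  rcases i with i | i
  · exact displaced_le_inl h0 hst (Classical.arbitrary β) hf hg x i
  · rw [displaced_swap, mul_comm C D]
    exact displaced_le_inl h0 hst (Classical.arbitrary α) hg hf (x ∘ Sum.swap) i

end Bound

/-- The density of the particles is dominated by the heat kernel of each of them. -/
lemma exists_density_le (T : Genealogy) (t₀ : ℝ) : ∃ C : ℝ≥0∞, C ≠ ∞ ∧
    ∀ t, 0 < t → t ≤ t₀ → ∀ x i, density T t x ≤ C * heat t (x i) := by
  induction T with
  | leaf =>
    refine ⟨1, ENNReal.one_ne_top, fun t h0 _ x i => ?_⟩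
    simp only [density]
    gcongr
    rw [ENNReal.ofReal_le_one, Real.exp_le_one_iff]
    linarith
  | node l r hl hr =>
    obtain ⟨C, hC, hl⟩ := hl
    obtain ⟨D, hD, hr⟩ := hr
    -- The two subtrees are evaluated at times `t - s ≤ t₀`, so their constants apply uniformly in
    -- `s`; the integral is the price of the factor `heatMax (t - s)`.
    refine ⟨C * D * ∫⁻ r in Set.Ioo 0 t₀, heatMax r, by finiteness [lintegral_heatMax_Ioo t₀],
      fun t h0 ht x i => ?_⟩
    calc density (node l r) t x
        ≤ ∫⁻ s in Set.Iio t, (C * D * heat t (x i)) * heatMax (t - s) ∂(expMeasure 1) := by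
          simp only [density]
          refine lintegral_mono_ae ?_
          filter_upwards [ae_restrict_of_ae ae_pos_expMeasure,
            ae_restrict_mem measurableSet_Iio] with s hs hst
          refine (displaced_le hs hst (hl _ (sub_pos.2 hst) (by linarith))
            (hr _ (sub_pos.2 hst) (by linarith)) x i).trans_eq ?_
          ring
      _ = (C * D * heat t (x i)) * ∫⁻ s in Set.Iio t, heatMax (t - s) ∂(expMeasure 1) :=
          lintegral_const_mul _ (by fun_prop)
      _ ≤ (C * D * heat t (x i)) * ∫⁻ r in Set.Ioo 0 t₀, heatMax r := by
          exact mul_le_mul_right (setLIntegral_expMeasure_heatMax_le ht) _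
      _ = _ := by ring

/-- Dominated convergence in the displacement: at the fixed time `t - s > 0` both subtree densities
are bounded, and `heat s` is integrable. -/
lemma continuous_displaced {α β : Type} [Finite α] [Finite β] [Nonempty α] [Nonempty β]
    {f : ℝ → (α → ℝ) → ℝ≥0∞}
    {g : ℝ → (β → ℝ) → ℝ≥0∞} {t s : ℝ} {C D : ℝ≥0∞} (h0 : 0 < s) (hst : s < t)
    (hC : C ≠ ∞) (hD : D ≠ ∞)
    (hfm : Measurable (fun p : ℝ × (α → ℝ) => f p.1 p.2))
    (hgm : Measurable (fun p : ℝ × (β → ℝ) => g p.1 p.2))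
    (hf : ∀ x i, f (t - s) x ≤ C * heat (t - s) (x i))
    (hg : ∀ x i, g (t - s) x ≤ D * heat (t - s) (x i))
    (hfc : Continuous (f (t - s))) (hgc : Continuous (g (t - s))) :
    Continuous (displaced f g t s) := by
  have ht : 0 < t - s := sub_pos.2 hst
  have hf' : ∀ x, f (t - s) x ≤ C * heatMax (t - s) := fun x =>
    (hf x (Classical.arbitrary _)).trans (by gcongr; exact heat_le_heatMax ht _)
  have hg' : ∀ x, g (t - s) x ≤ D * heatMax (t - s) := fun x =>
    (hg x (Classical.arbitrary _)).trans (by gcongr; exact heat_le_heatMax ht _)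
  -- Finiteness matters because multiplication in `ℝ≥0∞` is discontinuous at `(0, ∞)`.
  have hf'' : ∀ x, f (t - s) x ≠ ∞ := fun x =>
    ne_top_of_le_ne_top (ENNReal.mul_ne_top hC (heatMax_ne_top _)) (hf' x)
  have hg'' : ∀ x, g (t - s) x ≠ ∞ := fun x =>
    ne_top_of_le_ne_top (ENNReal.mul_ne_top hD (heatMax_ne_top _)) (hg' x)
  refine continuous_iff_continuousAt.2 fun x => ?_
  refine tendsto_lintegral_filter_of_dominated_convergence
    (fun z => heat s z * ((C * heatMax (t - s)) * (D * heatMax (t - s)))) ?_ ?_ ?_ ?_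
  · refine Eventually.of_forall fun y => ?_
    exact (measurable_displaced_integrand hfm hgm).comp
      (measurable_prodMk_left (x := ((t, s), y)))
  · exact Eventually.of_forall fun y => Eventually.of_forall fun z => by
      gcongr
      · exact hf' _
      · exact hg' _
  · rw [lintegral_mul_const _ (measurable_heat_comp (by fun_prop) (by fun_prop)),
      lintegral_heat h0, one_mul]
    finiteness [heatMax_ne_top (t - s)]
  · refine Eventually.of_forall fun z => ?_
    refine ENNReal.Tendsto.const_mul (ENNReal.Tendsto.mul ?_ (Or.inr (hg'' _)) ?_
      (Or.inr (hf'' _))) (Or.inr (heat_ne_top _ _))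
    · exact (hfc.comp (by fun_prop :
        Continuous fun y : α ⊕ β → ℝ => fun i : α => y (Sum.inl i) - z)).tendsto x
    · exact (hgc.comp (by fun_prop :
        Continuous fun y : α ⊕ β → ℝ => fun i : β => y (Sum.inr i) - z)).tendsto x

/-- At a node, dominated convergence in the split time with majorant a multiple of `heatMax (t -
s)`; for almost every `s` the integrand is continuous by `continuous_displaced`. -/
lemma continuous_density (T : Genealogy) {t : ℝ} (ht : 0 < t) : Continuous (density T t) := by
  induction T generalizing t with
  | leaf =>
    simp only [density]
    exact (ENNReal.continuous_const_mul ENNReal.ofReal_ne_top).comp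
      ((continuous_heat t).comp (continuous_apply _))
  | node l r hl hr =>
    obtain ⟨C, hC, hlb⟩ := exists_density_le l t
    obtain ⟨D, hD, hrb⟩ := exists_density_le r t
    refine continuous_iff_continuousAt.2 fun x => ?_
    simp only [ContinuousAt, density]
    refine tendsto_lintegral_filter_of_dominated_convergence
      (fun s => (C * D * heatMax t) * heatMax (t - s)) ?_ ?_ ?_ ?_
    · exact Eventually.of_forall fun y => measurable_displaced_split l r t y
    · refine Eventually.of_forall fun y => ?_
      filter_upwards [ae_restrict_of_ae ae_pos_expMeasure,
        ae_restrict_mem measurableSet_Iio] with s hs hst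
      have i : Leaf (node l r) := Classical.arbitrary _
      calc _ ≤ C * D * heatMax (t - s) * heat t (y i) :=
            displaced_le hs hst (hlb _ (sub_pos.2 hst) (by linarith))
              (hrb _ (sub_pos.2 hst) (by linarith)) y i
        _ ≤ C * D * heatMax (t - s) * heatMax t := by gcongr; exact heat_le_heatMax ht _
        _ = _ := by ring
    · rw [lintegral_const_mul _ (by fun_prop)]
      have := ((setLIntegral_expMeasure_heatMax_le (le_refl t)).trans_lt
        (lintegral_heatMax_Ioo t)).ne
      finiteness [heatMax_ne_top t]
    · filter_upwards [ae_restrict_of_ae ae_pos_expMeasure,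
        ae_restrict_mem measurableSet_Iio] with s hs hst
      exact (continuous_displaced hs hst hC hD (measurable_density l) (measurable_density r)
        (hlb _ (sub_pos.2 hst) (by linarith)) (hrb _ (sub_pos.2 hst) (by linarith))
        (hl (sub_pos.2 hst)) (hr (sub_pos.2 hst))).tendsto x

end Genealogy

/-! ### Decomposition of the population at the first split. -/

section Combinatorics

variable {Ω : Type*} (τ : List Bool → Ω → ℝ) (B : List Bool → ℝ≥0 → Ω → ℝ)

lemma birth_nil (ω : Ω) : birth τ [] ω = 0 := by simp [birth]

/-- Seen from a child of the root the process is of the same kind, with the clock shifted by the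
lifetime of the root. This, `position_cons` and `cons_mem_alive` drive the inductions below. -/
lemma birth_cons (b : Bool) (u : List Bool) (ω : Ω) :
    birth τ (b :: u) ω = τ [] ω + birth (fun v => τ (b :: v)) u ω := by
  simp [birth, Finset.sum_range_succ', add_comm]

lemma position_cons (b : Bool) (u : List Bool) (t : ℝ) (ω : Ω) :
    position τ B (b :: u) t ω = B [] (τ [] ω).toNNReal ω +
      position (fun v => τ (b :: v)) (fun v => B (b :: v)) u (t - τ [] ω) ω := by
  simp only [position, birth_cons, List.length_cons, Finset.sum_range_succ', List.take_succ_cons,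
    List.take_zero]
  rw [sub_add_eq_sub_sub]
  ring

lemma position_nil (t : ℝ) (ω : Ω) : position τ B [] t ω = B [] t.toNNReal ω := by
  simp [position, birth_nil]

lemma nil_mem_alive {t : ℝ} {ω : Ω} : [] ∈ alive τ t ω ↔ 0 ≤ t ∧ t < τ [] ω := by
  simp [alive, birth_nil]

lemma cons_mem_alive {b : Bool} {u : List Bool} {t : ℝ} {ω : Ω} :
    b :: u ∈ alive τ t ω ↔ u ∈ alive (fun v => τ (b :: v)) (t - τ [] ω) ω := by
  simp only [alive, Set.mem_ofPred_eq, birth_cons]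
  constructor <;> rintro ⟨h1, h2⟩ <;> constructor <;> linarith

variable {τ B}

lemma birth_nonneg (hτ : ∀ u ω, 0 < τ u ω) (u : List Bool) (ω : Ω) : 0 ≤ birth τ u ω :=
  Finset.sum_nonneg fun _ _ => (hτ _ _).le

lemma alive_of_neg (hτ : ∀ u ω, 0 < τ u ω) {t : ℝ} (ht : t < 0) (ω : Ω) : alive τ t ω = ∅ := by
  ext u
  simp only [alive, Set.mem_ofPred_eq, Set.mem_empty_iff_false, iff_false, not_and]
  intro h
  linarith [birth_nonneg hτ u ω]

lemma alive_of_lt (hτ : ∀ u ω, 0 < τ u ω) {t : ℝ} {ω : Ω} (h0 : 0 ≤ t) (ht : t < τ [] ω) :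
    alive τ t ω = {[]} := by
  ext u
  rcases u with _ | ⟨b, u⟩
  · simp [nil_mem_alive, h0, ht]
  · simp only [cons_mem_alive, Set.mem_singleton_iff, reduceCtorEq, iff_false]
    rw [alive_of_neg (fun _ _ => hτ _ _) (by linarith)]
    simp

open Genealogy in
lemma alive_eq_leaf_iff (hτ : ∀ u ω, 0 < τ u ω) {t : ℝ} (h0 : 0 ≤ t) {ω : Ω} :
    alive τ t ω = Set.range (label leaf) ↔ t < τ [] ω := by
  have hr : Set.range (label leaf) = {[]} := by
    ext; simp [label]
  rw [hr]
  refine ⟨fun h => ?_, alive_of_lt hτ h0⟩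
  have : [] ∈ alive τ t ω := by simp [h]
  exact ((nil_mem_alive τ).1 this).2

open Genealogy in
lemma alive_eq_node_iff (hτ : ∀ u ω, 0 < τ u ω) {t : ℝ} {ω : Ω} (l r : Genealogy) :
    alive τ t ω = Set.range (label (node l r)) ↔
      alive (fun v => τ (false :: v)) (t - τ [] ω) ω = Set.range (label l) ∧
      alive (fun v => τ (true :: v)) (t - τ [] ω) ω = Set.range (label r) := by
  have hf : ∀ u, false :: u ∈ Set.range (label (node l r)) ↔ u ∈ Set.range (label l) := by
    intro u; simp [label]
  have ht : ∀ u, true :: u ∈ Set.range (label (node l r)) ↔ u ∈ Set.range (label r) := by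
    intro u; simp [label]
  have hn : [] ∉ Set.range (label (node l r)) := by
    simp [label]
  constructor
  · intro h
    constructor <;> ext u
    · rw [← hf, ← h, cons_mem_alive]
    · rw [← ht, ← h, cons_mem_alive]
  · rintro ⟨h1, h2⟩
    -- A genealogy has a leaf, so the subtree of a child is inhabited and the root must have split
    -- by time `t`.
    have h0 : 0 ≤ t - τ [] ω := by
      by_contra hneg
      rw [alive_of_neg (fun _ _ => hτ _ _) (not_le.1 hneg)] at h1
      exact (Set.range_nonempty (label l)).ne_empty h1.symm
    ext u
    rcases u with _ | ⟨b, u⟩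
    · simp only [hn, iff_false, nil_mem_alive]
      rintro ⟨_, h⟩
      linarith
    · cases b
      · rw [hf, cons_mem_alive, h1]
      · rw [ht, cons_mem_alive, h2]

/-- If the generation `d` is not born at time `t`, the particles alive form a genealogy. -/
lemma exists_alive_eq_range_label (d : ℕ) {τ : List Bool → Ω → ℝ} (hτ : ∀ u ω, 0 < τ u ω) {t : ℝ}
    (h0 : 0 ≤ t) {ω : Ω} (h : ∀ u, u.length = d → t < birth τ u ω) :
    ∃ T, alive τ t ω = Set.range (Genealogy.label T) := by
  induction d generalizing τ t with
  | zero =>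
    -- The root is born at time `0 ≤ t`, so generation `0` cannot be unborn.
    have := h [] rfl
    rw [birth_nil] at this
    linarith
  | succ d ih =>
    rcases lt_or_ge t (τ [] ω) with ht | ht
    · exact ⟨.leaf, (alive_eq_leaf_iff hτ h0).2 ht⟩
    · have key : ∀ b : Bool, ∃ T, alive (fun v => τ (b :: v)) (t - τ [] ω) ω =
          Set.range (Genealogy.label T) := fun b => by
        refine ih (fun _ _ => hτ _ _) (by linarith) fun u hu => ?_
        have := h (b :: u) (by simp [hu])
        rw [birth_cons] at this
        linarith
      obtain ⟨l, hl⟩ := key false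
      obtain ⟨r, hr⟩ := key true
      exact ⟨.node l r, (alive_eq_node_iff hτ l r).2 ⟨hl, hr⟩⟩

end Combinatorics

/-! ### Joint measurability in time and sample. -/

section Measurability

variable {Ω : Type*} [MeasurableSpace Ω] {τ : List Bool → Ω → ℝ} {B : List Bool → ℝ≥0 → Ω → ℝ}

lemma measurable_birth (hτ : ∀ u, Measurable (τ u)) (u : List Bool) : Measurable (birth τ u) :=
  Finset.measurable_fun_sum _ fun _ _ => hτ _

lemma measurableSet_mem_alive (hτ : ∀ u, Measurable (τ u)) (u : List Bool) :
    MeasurableSet {p : ℝ × Ω | u ∈ alive τ p.1 p.2} := by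
  have h := measurable_birth hτ u
  have h2 := hτ u
  have h3 : MeasurableSet {p : ℝ × Ω | birth τ u p.2 ≤ p.1} :=
    measurableSet_le (by fun_prop) (by fun_prop)
  have h4 : MeasurableSet {p : ℝ × Ω | p.1 < birth τ u p.2 + τ u p.2} :=
    measurableSet_lt (by fun_prop) (by fun_prop)
  exact h3.inter h4

/-- Equality of sets is tested word by word, and there are countably many words. -/
lemma measurableSet_alive_eq (hτ : ∀ u, Measurable (τ u)) (S : Set (List Bool)) :
    MeasurableSet {p : ℝ × Ω | alive τ p.1 p.2 = S} := by
  have : {p : ℝ × Ω | alive τ p.1 p.2 = S} =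
      ⋂ u, {p : ℝ × Ω | u ∈ alive τ p.1 p.2 ↔ u ∈ S} := by
    ext p; simp [Set.ext_iff]
  rw [this]
  refine MeasurableSet.iInter fun u => ?_
  by_cases hu : u ∈ S
  · simpa [hu] using measurableSet_mem_alive hτ u
  · simp only [hu, iff_false]
    exact (measurableSet_mem_alive hτ u).compl

lemma measurableSet_alive_eq_right (hτ : ∀ u, Measurable (τ u)) (S : Set (List Bool)) (t : ℝ) :
    MeasurableSet {ω | alive τ t ω = S} :=
  measurable_prodMk_left (x := t) (measurableSet_alive_eq hτ S)

/-- Continuity of the paths upgrades measurability at fixed times to joint measurability, which is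
what allows evaluation at random times. -/
lemma measurable_motion_uncurry (hB : ∀ u s, Measurable (B u s))
    (hc : ∀ u ω, Continuous fun s => B u s ω) (u : List Bool) :
    Measurable (fun p : ℝ≥0 × Ω => B u p.1 p.2) :=
  measurable_uncurry_of_continuous_of_measurable (hc u) (hB u)

lemma measurable_position (hτ : ∀ u, Measurable (τ u)) (hB : ∀ u s, Measurable (B u s))
    (hc : ∀ u ω, Continuous fun s => B u s ω) (u : List Bool) :
    Measurable (fun p : ℝ × Ω => position τ B u p.1 p.2) := by
  have hb := measurable_birth hτ u
  unfold position
  refine Measurable.add (Finset.measurable_fun_sum _ fun k _ => ?_) ?_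
  · have h := hτ (u.take k)
    exact (measurable_motion_uncurry hB hc (u.take k)).comp
      (f := fun p : ℝ × Ω => ((τ (u.take k) p.2).toNNReal, p.2)) (by fun_prop)
  · exact (measurable_motion_uncurry hB hc u).comp
      (f := fun p : ℝ × Ω => ((p.1 - birth τ u p.2).toNNReal, p.2)) (by fun_prop)

lemma measurable_position_right (hτ : ∀ u, Measurable (τ u)) (hB : ∀ u s, Measurable (B u s))
    (hc : ∀ u ω, Continuous fun s => B u s ω) (u : List Bool) (t : ℝ) :
    Measurable (position τ B u t) :=
  (measurable_position hτ hB hc u).comp measurable_prodMk_left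

end Measurability

/-! ### Independence and the branching property. -/

/-- The space `Ω` with a coarser σ-algebra. -/
def Coarse {Ω : Type*} (_ : MeasurableSpace Ω) : Type _ := Ω

instance {Ω : Type*} (m : MeasurableSpace Ω) : MeasurableSpace (Coarse m) := m

/-- The identity map to a coarser measurable space. -/
def toCoarse {Ω : Type*} (m : MeasurableSpace Ω) (ω : Ω) : Coarse m := ω

lemma measurable_toCoarse {Ω : Type*} {m : MeasurableSpace Ω} [m0 : MeasurableSpace Ω]
    (hm : m ≤ m0) : Measurable (toCoarse m) := fun _ hs => hm _ hs

lemma measurable_toCoarse_of_le {Ω : Type*} {m m' : MeasurableSpace Ω} (hm : m ≤ m') :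
    Measurable (fun ω : Coarse m' => toCoarse m ω) := fun _ hs => hm _ hs

/-- Freezing lemma: independence says that the diagonal map into `(Ω, m₁) × (Ω, m₂)` sends `P` to a
product measure. Using `Ω` itself with coarser σ-algebras avoids encoding each subtree as a random
variable in a concrete space. -/
lemma lintegral_diagonal_of_indep {Ω : Type*} {m₁ m₂ : MeasurableSpace Ω}
    [m0 : MeasurableSpace Ω] {P : Measure Ω} [IsProbabilityMeasure P] (h₁ : m₁ ≤ m0) (h₂ : m₂ ≤ m0)
    (h : Indep m₁ m₂ P) {F : Ω → Ω → ℝ≥0∞}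
    (hF : Measurable (fun p : Coarse m₁ × Coarse m₂ => F p.1 p.2)) :
    ∫⁻ ω, F ω ω ∂P = ∫⁻ ω, ∫⁻ ω', F ω ω' ∂P ∂P := by
  have hi : IndepFun (toCoarse m₁) (toCoarse m₂) P := by
    have e₁ : MeasurableSpace.comap (toCoarse m₁) inferInstance = m₁ := MeasurableSpace.comap_id
    have e₂ : MeasurableSpace.comap (toCoarse m₂) inferInstance = m₂ := MeasurableSpace.comap_id
    rw [IndepFun_iff_Indep, e₁, e₂]
    exact h
  have hm₁ := measurable_toCoarse h₁
  have hm₂ := measurable_toCoarse h₂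
  have key := hi.map_prod_eq_prod_map_map hm₁.aemeasurable hm₂.aemeasurable
  calc ∫⁻ ω, F ω ω ∂P
      = ∫⁻ p, F p.1 p.2 ∂(P.map fun ω => (toCoarse m₁ ω, toCoarse m₂ ω)) :=
        (lintegral_map hF (hm₁.prodMk hm₂)).symm
    _ = ∫⁻ ω, ∫⁻ ω', F ω ω' ∂(P.map (toCoarse m₂)) ∂(P.map (toCoarse m₁)) := by
        rw [key, lintegral_prod _ hF.aemeasurable]
    _ = ∫⁻ ω, ∫⁻ ω', F ω ω' ∂(P.map (toCoarse m₂)) ∂P :=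
        lintegral_map hF.lintegral_prod_right' hm₁
    _ = _ := by
        refine lintegral_congr fun ω => ?_
        exact lintegral_map (hF.comp measurable_prodMk_left) hm₂

/-- The σ-algebra generated by a function. -/
@[reducible]
def sigmaBy {Ω β : Type*} [MeasurableSpace β] (f : Ω → β) : MeasurableSpace Ω :=
  MeasurableSpace.comap f inferInstance

/-- A branching Brownian motion whose lifetimes are positive and whose paths are continuous
everywhere, not just almost surely. Of the motions only the one-dimensional laws are recorded. -/
structure Regular {Ω : Type*} [MeasurableSpace Ω] (P : Measure Ω)
    (τ : List Bool → Ω → ℝ) (B : List Bool → ℝ≥0 → Ω → ℝ) : Prop where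
  measurable_lifetime : ∀ u, Measurable (τ u)
  lifetime_pos : ∀ u ω, 0 < τ u ω
  measurable_motion : ∀ u s, Measurable (B u s)
  continuous_motion : ∀ u ω, Continuous fun s => B u s ω
  lifetime_law : ∀ u, P.map (τ u) = expMeasure 1
  motion_law : ∀ u s, P.map (B u s) = gaussianReal 0 s
  indep_lifetime_motion : ∀ u, IndepFun (τ u) (fun ω s => B u s ω) P
  indep_particles : iIndepFun (fun u ω => (τ u ω, fun s => B u s ω)) P

/-- The σ-algebra generated by the lifetimes and motions of the particles in `S`. -/
@[reducible]
def sigmaOf {Ω : Type*} (τ : List Bool → Ω → ℝ) (B : List Bool → ℝ≥0 → Ω → ℝ)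
    (S : Set (List Bool)) : MeasurableSpace Ω :=
  ⨆ u ∈ S, MeasurableSpace.comap (fun ω => (τ u ω, fun s => B u s ω)) inferInstance

section SigmaOf

variable {Ω : Type*} {τ : List Bool → Ω → ℝ} {B : List Bool → ℝ≥0 → Ω → ℝ}

lemma measurable_pair_sigmaOf {S : Set (List Bool)} {u : List Bool} (hu : u ∈ S) :
    Measurable (fun ω : Coarse (sigmaOf τ B S) => (τ u ω, fun s => B u s ω)) := by
  rw [measurable_iff_comap_le]
  exact le_iSup₂_of_le (f := fun u (_ : u ∈ S) =>
    MeasurableSpace.comap (fun ω => (τ u ω, fun s => B u s ω)) inferInstance) u hu le_rfl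

lemma measurable_lifetime_sigmaOf {S : Set (List Bool)} {u : List Bool} (hu : u ∈ S) :
    Measurable (fun ω : Coarse (sigmaOf τ B S) => τ u ω) :=
  (measurable_pair_sigmaOf hu).fst

lemma measurable_motion_sigmaOf {S : Set (List Bool)} {u : List Bool} (hu : u ∈ S) (s : ℝ≥0) :
    Measurable (fun ω : Coarse (sigmaOf τ B S) => B u s ω) :=
  measurable_pi_iff.1 (measurable_pair_sigmaOf hu).snd s

lemma sigmaOf_mono {S S' : Set (List Bool)} (h : S ⊆ S') : sigmaOf τ B S ≤ sigmaOf τ B S' :=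
  biSup_mono h

end SigmaOf

namespace Regular

variable {Ω : Type*} [m0 : MeasurableSpace Ω] {P : Measure Ω}
  {τ : List Bool → Ω → ℝ} {B : List Bool → ℝ≥0 → Ω → ℝ}

lemma subtree (h : Regular P τ B) (b : Bool) :
    Regular P (fun u => τ (b :: u)) (fun u => B (b :: u)) where
  measurable_lifetime _ := h.measurable_lifetime _
  lifetime_pos _ _ := h.lifetime_pos _ _
  measurable_motion _ _ := h.measurable_motion _ _
  continuous_motion _ _ := h.continuous_motion _ _
  lifetime_law _ := h.lifetime_law _
  motion_law _ _ := h.motion_law _ _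
  indep_lifetime_motion _ := h.indep_lifetime_motion _
  indep_particles := h.indep_particles.precomp (g := List.cons b) (List.cons_injective)

lemma measurable_path (h : Regular P τ B) (u : List Bool) : Measurable (fun ω s => B u s ω) :=
  measurable_pi_iff.2 fun s => h.measurable_motion u s

lemma sigmaOf_le (h : Regular P τ B) (S : Set (List Bool)) : sigmaOf τ B S ≤ m0 :=
  iSup₂_le fun u _ => ((h.measurable_lifetime u).prodMk (h.measurable_path u)).comap_le

lemma indep_sigmaOf (h : Regular P τ B) {S S' : Set (List Bool)} (hS : Disjoint S S') :
    Indep (sigmaOf τ B S) (sigmaOf τ B S') P :=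
  indep_iSup_of_disjoint
    (fun u => ((h.measurable_lifetime u).prodMk (h.measurable_path u)).comap_le)
    h.indep_particles hS

variable [IsProbabilityMeasure P]

/-- The lifetime is frozen at `s` by independence of the motion, and then only the law of the motion
at the fixed time `s` matters. -/
lemma lintegral_lifetime_motion (h : Regular P τ B) (u : List Bool) {Φ : ℝ → ℝ → ℝ≥0∞}
    (hΦ : Measurable (fun p : ℝ × ℝ => Φ p.1 p.2)) :
    ∫⁻ ω, Φ (τ u ω) (B u (τ u ω).toNNReal ω) ∂P =
      ∫⁻ s, ∫⁻ z, Φ s z ∂(gaussianReal 0 s.toNNReal) ∂(expMeasure 1) := by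
  have hτ : Measurable (fun ω : Coarse (sigmaBy (τ u)) => τ u ω) := measurable_iff_comap_le.2 le_rfl
  have hB' : Measurable (fun ω : Coarse (sigmaBy fun ω s => B u s ω) => fun s => B u s ω) :=
    measurable_iff_comap_le.2 le_rfl
  have hB : Measurable (fun p : ℝ≥0 × Coarse (sigmaBy fun ω s => B u s ω) => B u p.1 p.2) :=
    measurable_uncurry_of_continuous_of_measurable
      (u := fun s (ω : Coarse (sigmaBy fun ω s => B u s ω)) => B u s ω)
      (fun ω => h.continuous_motion u ω) (fun s => measurable_pi_iff.1 hB' s)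
  have hΨ : Measurable (fun p : ℝ × Coarse (sigmaBy fun ω s => B u s ω) =>
      Φ p.1 (B u p.1.toNNReal p.2)) :=
    hΦ.comp (measurable_fst.prodMk
      (hB.comp (f := fun p : ℝ × Coarse (sigmaBy fun ω s => B u s ω) => (p.1.toNNReal, p.2))
        (by fun_prop)))
  rw [lintegral_diagonal_of_indep (m₁ := sigmaBy (τ u)) (m₂ := sigmaBy fun ω s => B u s ω)
    (F := fun ω ω' => Φ (τ u ω) (B u (τ u ω).toNNReal ω'))
    (h.measurable_lifetime u).comap_le (h.measurable_path u).comap_le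
    ((IndepFun_iff_Indep _ _ _).1 (h.indep_lifetime_motion u))
    (hΨ.comp (f := fun p : Coarse (sigmaBy (τ u)) × Coarse (sigmaBy fun ω s => B u s ω) =>
      (τ u p.1, p.2)) (by fun_prop))]
  have hΨ' : Measurable (fun p : ℝ × Ω => Φ p.1 (B u p.1.toNNReal p.2)) :=
    hΨ.comp (f := fun p : ℝ × Ω => (p.1, toCoarse (sigmaBy fun ω s => B u s ω) p.2))
      (measurable_fst.prodMk ((measurable_toCoarse (h.measurable_path u).comap_le).comp measurable_snd))
  have inner : ∀ s, ∫⁻ z, Φ s z ∂(gaussianReal 0 s.toNNReal) =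
      ∫⁻ ω', Φ s (B u s.toNNReal ω') ∂P := fun s => by
    have hs : Measurable (Φ s) := hΦ.comp measurable_prodMk_left
    rw [← h.motion_law u, lintegral_map hs (h.measurable_motion _ _)]
  simp_rw [inner]
  rw [← h.lifetime_law u, lintegral_map hΨ'.lintegral_prod_right' (h.measurable_lifetime u)]

/-- The root and the two subtrees are independent: branching property. -/
lemma lintegral_branching (h : Regular P τ B) {F : ℝ → ℝ → Ω → Ω → ℝ≥0∞}
    (hF : Measurable (fun p : (ℝ × ℝ) × (Coarse (sigmaOf τ B (Set.range (List.cons false))) ×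
      Coarse (sigmaOf τ B (Set.range (List.cons true)))) => F p.1.1 p.1.2 p.2.1 p.2.2)) :
    ∫⁻ ω, F (τ [] ω) (B [] (τ [] ω).toNNReal ω) ω ω ∂P =
      ∫⁻ s, ∫⁻ z, ∫⁻ ω, ∫⁻ ω', F s z ω ω' ∂P ∂P ∂(gaussianReal 0 s.toNNReal) ∂(expMeasure 1) := by
  set S₀ : Set (List Bool) := {[]}
  set S₁ : Set (List Bool) := Set.range (List.cons false)
  set S₂ : Set (List Bool) := Set.range (List.cons true)
  have h12 : Disjoint S₁ S₂ := by
    rw [Set.disjoint_left]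
    rintro _ ⟨u, rfl⟩ ⟨v, hv⟩
    simp at hv
  have h0 : Disjoint S₀ (S₁ ∪ S₂) := by
    simp [S₀, S₁, S₂]
  have hτ : Measurable (fun ω : Coarse (sigmaOf τ B S₀) => τ [] ω) :=
    measurable_lifetime_sigmaOf (Set.mem_singleton _)
  have hB : Measurable (fun p : ℝ≥0 × Coarse (sigmaOf τ B S₀) => B [] p.1 p.2) :=
    measurable_uncurry_of_continuous_of_measurable
      (u := fun s (ω : Coarse (sigmaOf τ B S₀)) => B [] s ω)
      (fun ω => h.continuous_motion [] ω)
      (fun s => measurable_motion_sigmaOf (Set.mem_singleton _) s)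
  have hZ : Measurable (fun ω : Coarse (sigmaOf τ B S₀) => B [] (τ [] ω).toNNReal ω) :=
    hB.comp (f := fun ω : Coarse (sigmaOf τ B S₀) => ((τ [] ω).toNNReal, ω)) (by fun_prop)
  have hc₁ := measurable_toCoarse_of_le
    (sigmaOf_mono (τ := τ) (B := B) (Set.subset_union_left : S₁ ⊆ S₁ ∪ S₂))
  have hc₂ := measurable_toCoarse_of_le
    (sigmaOf_mono (τ := τ) (B := B) (Set.subset_union_right : S₂ ⊆ S₁ ∪ S₂))
  -- The root is first separated from both subtrees together; `step` then separates the subtrees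
  -- from each other.
  rw [lintegral_diagonal_of_indep (m₁ := sigmaOf τ B S₀) (m₂ := sigmaOf τ B (S₁ ∪ S₂))
    (F := fun ω ω' => F (τ [] ω) (B [] (τ [] ω).toNNReal ω) ω' ω')
    (h.sigmaOf_le _) (h.sigmaOf_le _) (h.indep_sigmaOf h0)
    (hF.comp (f := fun p : Coarse (sigmaOf τ B S₀) × Coarse (sigmaOf τ B (S₁ ∪ S₂)) =>
      ((τ [] p.1, B [] (τ [] p.1).toNNReal p.1), (toCoarse _ p.2, toCoarse _ p.2)))
      (((hτ.comp measurable_fst).prodMk (hZ.comp measurable_fst)).prodMk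
        ((hc₁.comp measurable_snd).prodMk (hc₂.comp measurable_snd))))]
  have step : ∀ s z, ∫⁻ ω', F s z ω' ω' ∂P = ∫⁻ ω, ∫⁻ ω', F s z ω ω' ∂P ∂P := fun s z =>
    lintegral_diagonal_of_indep (m₁ := sigmaOf τ B S₁) (m₂ := sigmaOf τ B S₂)
      (F := fun ω ω' => F s z ω ω') (h.sigmaOf_le _) (h.sigmaOf_le _) (h.indep_sigmaOf h12)
      (hF.comp (measurable_prodMk_left (x := (s, z))))
  simp_rw [step]
  refine h.lintegral_lifetime_motion [] (Φ := fun s z => ∫⁻ ω, ∫⁻ ω', F s z ω ω' ∂P ∂P) ?_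
  have hd₁ := measurable_toCoarse (h.sigmaOf_le S₁)
  have hd₂ := measurable_toCoarse (h.sigmaOf_le S₂)
  have hF' : Measurable (fun p : ((ℝ × ℝ) × Ω) × Ω => F p.1.1.1 p.1.1.2 p.1.2 p.2) :=
    hF.comp (f := fun p : ((ℝ × ℝ) × Ω) × Ω => (p.1.1, (toCoarse _ p.1.2, toCoarse _ p.2)))
      (measurable_fst.fst.prodMk
        ((hd₁.comp measurable_fst.snd).prodMk (hd₂.comp measurable_snd)))
  exact (hF'.lintegral_prod_right' (ν := P)).lintegral_prod_right' (ν := P)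

/-- The branching property for functionals of the first lifetime and one of the subtrees. -/
lemma lintegral_first_split (h : Regular P τ B) (b : Bool) {F : ℝ → Ω → ℝ≥0∞}
    (hF : Measurable (fun p : ℝ × Coarse (sigmaOf τ B (Set.range (List.cons b))) => F p.1 p.2)) :
    ∫⁻ ω, F (τ [] ω) ω ∂P = ∫⁻ s, ∫⁻ ω, F s ω ∂P ∂(expMeasure 1) := by
  have h0 : Disjoint ({[]} : Set (List Bool)) (Set.range (List.cons b)) := by simp
  have hτ : Measurable (fun ω : Coarse (sigmaOf τ B {[]}) => τ [] ω) :=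
    measurable_lifetime_sigmaOf (Set.mem_singleton _)
  rw [lintegral_diagonal_of_indep (F := fun ω ω' => F (τ [] ω) ω') (h.sigmaOf_le _)
    (h.sigmaOf_le _) (h.indep_sigmaOf h0) (hF.comp (f := fun p : Coarse (sigmaOf τ B {[]}) ×
      Coarse (sigmaOf τ B (Set.range (List.cons b))) => (τ [] p.1, p.2)) (by fun_prop)),
    ← h.lifetime_law [], lintegral_map _ (h.measurable_lifetime _)]
  have hd := measurable_toCoarse (h.sigmaOf_le (Set.range (List.cons b)))
  have hF' : Measurable (fun p : ℝ × Ω => F p.1 p.2) :=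
    hF.comp (f := fun p : ℝ × Ω => (p.1, toCoarse _ p.2))
      (measurable_fst.prodMk (hd.comp measurable_snd))
  exact hF'.lintegral_prod_right'

end Regular

/-- A branching Brownian motion agrees almost surely with a regular one. -/
lemma IsBranchingBrownianMotion.exists_regular {Ω : Type*} [MeasurableSpace Ω] {P : Measure Ω}
    {τ : List Bool → Ω → ℝ} {B : List Bool → ℝ≥0 → Ω → ℝ}
    (h : IsBranchingBrownianMotion P τ B) :
    ∃ τ' B', Regular P τ' B' ∧ ∀ᵐ ω ∂P, ∀ u, τ u ω = τ' u ω ∧ ∀ s, B u s ω = B' u s ω := by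
  classical
  have hgood : ∀ᵐ ω ∂P, ∀ u, 0 < τ u ω ∧ Continuous fun s => B u s ω := by
    refine ae_all_iff.2 fun u => ?_
    have h1 : ∀ᵐ ω ∂P, 0 < τ u ω := by
      have := ae_pos_expMeasure
      rw [← (h.lifetime_law u).map_eq] at this
      exact ae_of_ae_map (h.measurable_lifetime u).aemeasurable this
    filter_upwards [h1, (h.brownian u).cont] with ω h1 h2 using ⟨h1, h2⟩
  -- The good samples need not form a measurable set, so `G` is the complement of a measurable hull
  -- of the bad ones.
  obtain ⟨G, hGsub, hGm, hG⟩ : ∃ G : Set Ω, (∀ ω ∈ G, ∀ u, 0 < τ u ω ∧ Continuous fun s => B u s ω)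
      ∧ MeasurableSet G ∧ ∀ᵐ ω ∂P, ω ∈ G := by
    refine ⟨(toMeasurable P {ω | ¬ ∀ u, 0 < τ u ω ∧ Continuous fun s => B u s ω})ᶜ, ?_,
      (measurableSet_toMeasurable _ _).compl, ?_⟩
    · intro ω hω
      by_contra hbad
      exact hω (subset_toMeasurable _ _ hbad)
    · rw [ae_iff]
      simp only [Set.mem_compl_iff, not_not, Set.ofPred_mem_eq, measure_toMeasurable]
      exact hgood
  -- Off `G` any positive lifetime and any continuous path would do.
  let τ' : List Bool → Ω → ℝ := fun u => G.piecewise (τ u) (fun _ => 1)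
  let B' : List Bool → ℝ≥0 → Ω → ℝ := fun u s => G.piecewise (B u s) (fun _ => 0)
  have hae : ∀ᵐ ω ∂P, ∀ u, τ u ω = τ' u ω ∧ ∀ s, B u s ω = B' u s ω := by
    filter_upwards [hG] with ω hω u
    simp [τ', B', hω]
  have hτ : ∀ u, τ u =ᵐ[P] τ' u := fun u => by
    filter_upwards [hae] with ω hω using (hω u).1
  have hB : ∀ u s, B u s =ᵐ[P] B' u s := fun u s => by
    filter_upwards [hae] with ω hω using (hω u).2 s
  have hBp : ∀ u, (fun ω s => B u s ω) =ᵐ[P] (fun ω s => B' u s ω) := fun u => by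
    filter_upwards [hae] with ω hω using funext fun s => (hω u).2 s
  refine ⟨τ', B', ⟨?_, ?_, ?_, ?_, ?_, ?_, ?_, ?_⟩, hae⟩
  · exact fun u => (h.measurable_lifetime u).piecewise hGm measurable_const
  · intro u ω
    by_cases hω : ω ∈ G
    · simpa [τ', hω] using (hGsub ω hω u).1
    · simp [τ', hω]
  · exact fun u s => (h.measurable_motion u s).piecewise hGm measurable_const
  · intro u ω
    by_cases hω : ω ∈ G
    · simpa [B', hω] using (hGsub ω hω u).2
    · simpa [B', hω] using continuous_const
  · intro u
    rw [← Measure.map_congr (hτ u), (h.lifetime_law u).map_eq]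
  · intro u s
    rw [← Measure.map_congr (hB u s), ((h.brownian u).hasLaw_eval s).map_eq]
  · exact fun u => (h.indep_lifetime_motion u).congr (hτ u) (hBp u)
  · refine h.indep_particles.congr fun u => ?_
    filter_upwards [hτ u, hBp u] with ω h1 h2
    exact Prod.ext h1 h2

/-! ### One-particle marginals of the genealogy densities. -/

namespace Genealogy

lemma lintegral_sum_pi {α β : Type} [Fintype α] [Fintype β] {F : (α ⊕ β → ℝ) → ℝ≥0∞}
    (hF : Measurable F) :
    ∫⁻ x, F x = ∫⁻ y : α → ℝ, ∫⁻ w : β → ℝ, F (Sum.elim y w) := by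
  have h := volume_measurePreserving_sumPiEquivProdPi_symm (fun _ : α ⊕ β => ℝ)
  rw [← h.lintegral_comp hF, Measure.volume_eq_prod]
  refine (lintegral_prod _ (hF.comp h.measurable).aemeasurable).trans ?_
  refine lintegral_congr fun y => lintegral_congr fun w => ?_
  refine congrArg F (funext fun i => ?_)
  rcases i with i | i <;> rfl

lemma measurable_sumElim_shift {α β : Type} :
    Measurable (fun p : (ℝ × (α → ℝ)) × (β → ℝ) =>
      Sum.elim (fun i => p.1.1 + p.1.2 i) (fun i => p.1.1 + p.2 i)) := by
  refine measurable_pi_iff.2 fun i => ?_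
  rcases i with i | i
  · simp only [Sum.elim_inl]; fun_prop
  · simp only [Sum.elim_inr]; fun_prop

/-- Tonelli, then translation of both groups of coordinates by `z`: the displacement is drawn first
and the two subtrees are placed relative to it. -/
lemma lintegral_displaced_mul {α β : Type} [Fintype α] [Fintype β]
    {f : ℝ → (α → ℝ) → ℝ≥0∞} {g : ℝ → (β → ℝ) → ℝ≥0∞}
    (hf : Measurable (fun p : ℝ × (α → ℝ) => f p.1 p.2))
    (hg : Measurable (fun p : ℝ × (β → ℝ) => g p.1 p.2)) (t s : ℝ)
    {F : (α ⊕ β → ℝ) → ℝ≥0∞} (hF : Measurable F) :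
    ∫⁻ x, displaced f g t s x * F x = ∫⁻ z, heat s z * ∫⁻ y, f (t - s) y * ∫⁻ w, g (t - s) w *
      F (Sum.elim (fun i => z + y i) (fun i => z + w i)) := by
  have hint := (measurable_displaced_integrand hf hg).comp
    (f := fun p : (α ⊕ β → ℝ) × ℝ => (((t, s), p.1), p.2)) (by fun_prop)
  have hfm : Measurable (f (t - s)) := hf.comp measurable_prodMk_left
  have hgm : Measurable (g (t - s)) := hg.comp measurable_prodMk_left
  calc ∫⁻ x, displaced f g t s x * F x
      = ∫⁻ x, ∫⁻ z, (heat s z * (f (t - s) (fun i => x (Sum.inl i) - z) *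
          g (t - s) (fun i => x (Sum.inr i) - z))) * F x := by
        refine lintegral_congr fun x => ?_
        exact (lintegral_mul_const _ (hint.comp measurable_prodMk_left)).symm
    _ = ∫⁻ z, ∫⁻ x, (heat s z * (f (t - s) (fun i => x (Sum.inl i) - z) *
          g (t - s) (fun i => x (Sum.inr i) - z))) * F x :=
        lintegral_lintegral_swap (hint.mul (hF.comp measurable_fst)).aemeasurable
    _ = _ := by
        refine lintegral_congr fun z => ?_
        have hG : Measurable fun x : α ⊕ β → ℝ => (f (t - s) (fun i => x (Sum.inl i) - z) *
            g (t - s) (fun i => x (Sum.inr i) - z)) * F x :=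
          ((hfm.comp (by fun_prop)).mul (hgm.comp (by fun_prop))).mul hF
        simp_rw [mul_assoc (heat s z)]
        rw [lintegral_const_mul _ hG, lintegral_sum_pi hG]
        congr 1
        rw [← lintegral_add_right_eq_self _ (fun _ : α => z)]
        refine lintegral_congr fun y => ?_
        have hy : (fun i => (y + fun _ : α => z) i - z) = y := by ext; simp
        have hm : Measurable fun w : β → ℝ => g (t - s) w *
            F (Sum.elim (fun i => z + y i) (fun i => z + w i)) :=
          hgm.mul (hF.comp (measurable_sumElim_shift.comp
            (f := fun w : β → ℝ => ((z, y), w)) (by fun_prop)))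
        rw [← lintegral_const_mul _ hm, ← lintegral_add_right_eq_self _ (fun _ : β => z)]
        refine lintegral_congr fun w => ?_
        have hw : (fun i => (w + fun _ : β => z) i - z) = w := by ext; simp
        simp only [Sum.elim_inl, Sum.elim_inr, hy, hw, mul_assoc]
        have he : Sum.elim (y + fun _ : α => z) (w + fun _ : β => z) =
            Sum.elim (fun i => z + y i) (fun i => z + w i) := by
          ext i; rcases i with i | i <;> simp [add_comm]
        rw [he]

/-- Tonelli in the split time. The nested form mirrors `Regular.lintegral_branching`, with which it
is compared in `Regular.setLIntegral_positions_eq`. -/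
lemma lintegral_density_node_mul (l r : Genealogy) (t : ℝ)
    {F : (Leaf (node l r) → ℝ) → ℝ≥0∞} (hF : Measurable F) :
    ∫⁻ x, density (node l r) t x * F x = ∫⁻ s in Set.Iio t, (∫⁻ z, heat s z *
      ∫⁻ y, density l (t - s) y * ∫⁻ w, density r (t - s) w *
        F (Sum.elim (fun i => z + y i) (fun i => z + w i))) ∂(expMeasure 1) := by
  have hm := measurable_displaced (measurable_density l) (measurable_density r)
  simp_rw [← lintegral_displaced_mul (measurable_density l) (measurable_density r) t _ hF]
  calc ∫⁻ x, density (node l r) t x * F x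
      = ∫⁻ x, ∫⁻ s in Set.Iio t, displaced (density l) (density r) t s x * F x
          ∂(expMeasure 1) := by
        refine lintegral_congr fun x => ?_
        rw [lintegral_mul_const _ (measurable_displaced_split l r t x)]
        rfl
    _ = _ := by
        refine lintegral_lintegral_swap (Measurable.aemeasurable ?_)
        exact (hm.comp (f := fun p : (Leaf (node l r) → ℝ) × ℝ => ((t, p.2), p.1))
          (by fun_prop)).mul (hF.comp measurable_fst)

lemma lintegral_heat_mul_lintegral_heat {s r : ℝ} (hs : 0 < s) (hr : 0 < r) {f : ℝ → ℝ≥0∞}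
    (hf : Measurable f) :
    ∫⁻ z, heat s z * ∫⁻ y, heat r y * f (z + y) = ∫⁻ y, heat (s + r) y * f y := by
  have hm : Measurable fun p : ℝ × ℝ => heat s p.1 * heat r (p.2 - p.1) * f p.2 :=
    ((measurable_heat_comp (by fun_prop) (by fun_prop)).fun_mul
      (measurable_heat_comp (by fun_prop) (by fun_prop))).fun_mul (hf.comp measurable_snd)
  calc ∫⁻ z, heat s z * ∫⁻ y, heat r y * f (z + y)
      = ∫⁻ z, ∫⁻ y, heat s z * heat r (y - z) * f y := by
        refine lintegral_congr fun z => ?_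
        rw [← lintegral_add_right_eq_self (fun y => heat s z * heat r (y - z) * f y) z,
          ← lintegral_const_mul]
        · refine lintegral_congr fun y => ?_
          rw [add_sub_cancel_right, mul_assoc, add_comm z]
        · exact (measurable_heat_comp (by fun_prop) (by fun_prop)).fun_mul (hf.comp (by fun_prop))
    _ = ∫⁻ y, ∫⁻ z, heat s z * heat r (y - z) * f y := lintegral_lintegral_swap hm.aemeasurable
    _ = _ := by
        refine lintegral_congr fun y => ?_
        rw [lintegral_mul_const _ ((measurable_heat_comp (by fun_prop) (by fun_prop)).fun_mul
          (measurable_heat_comp (by fun_prop) (by fun_prop))), lintegral_heat_mul_heat hs hr]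

lemma lintegral_pi_unit {f : ℝ → ℝ≥0∞} : ∫⁻ x : Unit → ℝ, f (x ()) = ∫⁻ y, f y :=
  (volume_preserving_funUnique Unit ℝ).lintegral_comp_emb (MeasurableEquiv.measurableEmbedding _) f

lemma measurable_lintegral_density (T : Genealogy) :
    Measurable (fun t => ∫⁻ x, density T t x) :=
  (measurable_density T).lintegral_prod_right'

/-- Every particle of a genealogy has the Gaussian law of a single Brownian particle. -/
lemma lintegral_density_mul_coord (T : Genealogy) {t : ℝ} (ht : 0 < t) (i : Leaf T)
    {f : ℝ → ℝ≥0∞} (hf : Measurable f) :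
    ∫⁻ x, density T t x * f (x i) = (∫⁻ x, density T t x) * ∫⁻ y, heat t y * f y := by
  induction T generalizing t f with
  | leaf =>
    simp only [density, mul_assoc]
    refine (lintegral_pi_unit (f := fun y => ENNReal.ofReal (Real.exp (-t)) *
      (heat t y * f y))).trans ?_
    rw [lintegral_const_mul _ ((continuous_heat t).measurable.fun_mul hf)]
    congr 1
    refine Eq.symm ((lintegral_pi_unit (f := fun y => ENNReal.ofReal (Real.exp (-t)) *
      heat t y)).trans ?_)
    rw [lintegral_const_mul _ (continuous_heat t).measurable, lintegral_heat ht, mul_one]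
  | node l r hl hr =>
    -- At split time `s` the subtree containing `i` contributes variance `t - s`, the displacement
    -- adds `s`, and the other subtree contributes only its mass. The total variance `t` does not
    -- depend on `s`, so the Gaussian integral factors out of the integral over `s`.
    have key : ∀ i : Leaf (node l r), ∀ f : ℝ → ℝ≥0∞, Measurable f → ∀ s, 0 < s → s < t →
        ∫⁻ z, heat s z * ∫⁻ y, density l (t - s) y * ∫⁻ w, density r (t - s) w *
          f (Sum.elim (fun i => z + y i) (fun i => z + w i) i) =
        ((∫⁻ y, density l (t - s) y) * ∫⁻ w, density r (t - s) w) * ∫⁻ y, heat t y * f y := by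
      intro i f hf s h0 hs
      have hs' : 0 < t - s := sub_pos.2 hs
      have hd := fun T => measurable_density_right T (t - s)
      have hz : ∀ z, ∫⁻ y, density l (t - s) y * ∫⁻ w, density r (t - s) w *
          f (Sum.elim (fun i => z + y i) (fun i => z + w i) i) =
          ((∫⁻ y, density l (t - s) y) * ∫⁻ w, density r (t - s) w) *
            ∫⁻ y, heat (t - s) y * f (z + y) := by
        intro z
        have hfz : Measurable fun y => f (z + y) := hf.comp (by fun_prop)
        rcases i with i | i
        · simp only [Sum.elim_inl]
          simp_rw [lintegral_mul_const _ (hd r), ← mul_assoc, mul_right_comm]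
          have hm : Measurable fun y : Leaf l → ℝ => density l (t - s) y * f (z + y i) :=
            (hd l).fun_mul (hfz.comp (measurable_pi_apply i))
          rw [lintegral_mul_const _ hm, hl hs' i hfz]
        · simp only [Sum.elim_inr]
          rw [hr hs' i hfz, lintegral_mul_const _ (hd l), mul_assoc]
      have hfm : Measurable fun z => ∫⁻ y, heat (t - s) y * f (z + y) :=
        Measurable.lintegral_prod_right' (f := fun p : ℝ × ℝ => heat (t - s) p.2 * f (p.1 + p.2))
          ((measurable_heat_comp (by fun_prop) (by fun_prop)).fun_mul (hf.comp (by fun_prop)))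
      simp_rw [hz, mul_left_comm (heat s _)]
      rw [lintegral_const_mul _ ((continuous_heat s).measurable.fun_mul hfm),
        lintegral_heat_mul_lintegral_heat h0 hs' hf]
      congr 3
      ext; congr 2; ring
    have hq : Measurable fun s =>
        (∫⁻ y, density l (t - s) y) * ∫⁻ w, density r (t - s) w :=
      ((measurable_lintegral_density l).fun_mul (measurable_lintegral_density r)).comp
        (measurable_const.sub measurable_id)
    have hone : ∫⁻ x, density (node l r) t x = ∫⁻ s in Set.Iio t,
        ((∫⁻ y, density l (t - s) y) * ∫⁻ w, density r (t - s) w) ∂(expMeasure 1) := by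
      have := lintegral_density_node_mul l r t (F := fun _ => 1) measurable_const
      simp only [mul_one] at this
      rw [this]
      refine lintegral_congr_ae ?_
      filter_upwards [ae_restrict_of_ae ae_pos_expMeasure,
        ae_restrict_mem measurableSet_Iio] with s h0 hs
      have := key i (fun _ => 1) measurable_const s h0 hs
      simpa [lintegral_heat ht] using this
    rw [hone, ← lintegral_mul_const _ hq,
      lintegral_density_node_mul l r t (F := fun x => f (x i)) (hf.comp (measurable_pi_apply i))]
    refine lintegral_congr_ae ?_
    filter_upwards [ae_restrict_of_ae ae_pos_expMeasure,
      ae_restrict_mem measurableSet_Iio] with s h0 hs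
    exact key i f hf s h0 hs

end Genealogy

/-! ### The law of the positions for a given genealogy. -/

open Genealogy

lemma expMeasure_Ioi {t : ℝ} (ht : 0 ≤ t) :
    expMeasure 1 (Set.Ioi t) = ENNReal.ofReal (Real.exp (-t)) := by
  rw [← setLIntegral_one, setLIntegral_expMeasure measurableSet_Ioi measurable_const,
    Set.Ioi_inter_Ioi, sup_eq_left.2 ht]
  simp only [mul_one]
  rw [← ofReal_integral_eq_lintegral_ofReal (integrableOn_exp_neg_Ioi t)
    (Eventually.of_forall fun s => (Real.exp_pos _).le), integral_exp_neg_Ioi]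

namespace Regular

variable {Ω : Type*} [m0 : MeasurableSpace Ω] {P : Measure Ω}
  {τ : List Bool → Ω → ℝ} {B : List Bool → ℝ≥0 → Ω → ℝ}

lemma measurable_positions (h : Regular P τ B) {ι : Type*} (e : ι → List Bool) (t : ℝ) :
    Measurable (fun ω i => position τ B (e i) t ω) :=
  measurable_pi_iff.2 fun i => measurable_position_right h.measurable_lifetime
    h.measurable_motion h.continuous_motion (e i) t

lemma measure_lt_lifetime (h : Regular P τ B) (u : List Bool) {t : ℝ} (ht : 0 ≤ t) :
    P {ω | t < τ u ω} = ENNReal.ofReal (Real.exp (-t)) := by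
  rw [← expMeasure_Ioi ht, ← h.lifetime_law u,
    Measure.map_apply (h.measurable_lifetime u) measurableSet_Ioi]
  rfl

variable [IsProbabilityMeasure P]

/-- The law of the positions on the event that the genealogy of the population is `T`. -/
lemma setLIntegral_positions_eq (h : Regular P τ B) (T : Genealogy) {t : ℝ} (ht : 0 < t)
    {F : (Leaf T → ℝ) → ℝ≥0∞} (hF : Measurable F) :
    ∫⁻ ω in {ω | alive τ t ω = Set.range (label T)},
      F (fun i => position τ B (label T i) t ω) ∂P = ∫⁻ x, density T t x * F x := by
  induction T generalizing τ B t with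
  | leaf =>
    simp_rw [alive_eq_leaf_iff h.lifetime_pos ht.le, label, position_nil]
    have hFc : Measurable fun y : ℝ => F (fun _ => y) := hF.comp (by fun_prop)
    have hA : MeasurableSet {ω | t < τ [] ω} :=
      measurableSet_lt measurable_const (h.measurable_lifetime [])
    -- Survival of the root is decided by its lifetime and its place by its motion, so the two
    -- factors of the density come from independence.
    have hind : IndepFun ((Set.Ioi t).indicator (fun _ => (1 : ℝ≥0∞)) ∘ τ [])
        ((fun p : ℝ≥0 → ℝ => F (fun _ => p t.toNNReal)) ∘ fun ω s => B [] s ω) P :=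
      (h.indep_lifetime_motion []).comp (measurable_const.indicator measurableSet_Ioi)
        (hFc.comp (measurable_pi_apply _))
    have hprod := lintegral_mul_eq_lintegral_mul_lintegral_of_indepFun
      ((measurable_const.indicator measurableSet_Ioi).comp (h.measurable_lifetime []))
      ((hFc.comp (measurable_pi_apply _)).comp (h.measurable_path [])) hind
    have hl : ∫⁻ ω in {ω | t < τ [] ω}, F (fun _ => B [] t.toNNReal ω) ∂P =
        P {ω | t < τ [] ω} * ∫⁻ ω, F (fun _ => B [] t.toNNReal ω) ∂P := by
      rw [← lintegral_indicator hA]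
      have h1 : ∫⁻ ω, ((Set.Ioi t).indicator (fun _ => (1 : ℝ≥0∞)) ∘ τ []) ω ∂P =
          P {ω | t < τ [] ω} := by
        rw [← lintegral_indicator_one hA]
        rfl
      rw [← h1]
      refine Eq.trans (lintegral_congr fun ω => ?_) hprod
      simp only [Set.indicator, Set.mem_ofPred_eq, Pi.mul_apply, Function.comp, Set.mem_Ioi]
      split_ifs <;> simp
    rw [hl, h.measure_lt_lifetime [] ht.le]
    have h2 : ∫⁻ ω, F (fun _ => B [] t.toNNReal ω) ∂P = ∫⁻ y, heat t y * F (fun _ => y) := by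
      rw [← lintegral_map (f := fun y => F (fun _ => y)) hFc (h.measurable_motion [] _),
        h.motion_law, gaussianReal_eq_withDensity_heat ht,
        lintegral_withDensity_eq_lintegral_mul _ (continuous_heat t).measurable hFc]
      rfl
    rw [h2, ← lintegral_const_mul _ ((continuous_heat t).measurable.fun_mul hFc)]
    refine ((lintegral_pi_unit (f := fun y => ENNReal.ofReal (Real.exp (-t)) *
      (heat t y * F (fun _ => y)))).symm.trans ?_)
    refine lintegral_congr fun x => ?_
    simp only [density, mul_assoc]
  | node l r hl hr =>
    set A₁ : ℝ → Set Ω := fun s =>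
      {ω | alive (fun v => τ (false :: v)) (t - s) ω = Set.range (label l)}
    set A₂ : ℝ → Set Ω := fun s =>
      {ω | alive (fun v => τ (true :: v)) (t - s) ω = Set.range (label r)}
    set X₁ : ℝ → Ω → Leaf l → ℝ := fun s ω i =>
      position (fun v => τ (false :: v)) (fun v => B (false :: v)) (label l i) (t - s) ω
    set X₂ : ℝ → Ω → Leaf r → ℝ := fun s ω i =>
      position (fun v => τ (true :: v)) (fun v => B (true :: v)) (label r i) (t - s) ω
    -- The sample is decoupled: `s` and `z` carry the root, `ω` the left subtree and `ω'` the right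
    -- one.
    set G : ℝ → ℝ → Ω → Ω → ℝ≥0∞ := fun s z ω ω' => (A₁ s).indicator (fun ω => (A₂ s).indicator
      (fun ω' => F (Sum.elim (fun i => z + X₁ s ω i) (fun i => z + X₂ s ω' i))) ω') ω with hG
    have hAm : MeasurableSet {ω | alive τ t ω = Set.range (label (node l r))} :=
      measurableSet_alive_eq_right h.measurable_lifetime _ _
    have hpos : (fun ω => fun i => position τ B (label (node l r) i) t ω) = fun ω =>
        Sum.elim (fun i => B [] (τ [] ω).toNNReal ω + X₁ (τ [] ω) ω i)
          (fun i => B [] (τ [] ω).toNNReal ω + X₂ (τ [] ω) ω i) := by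
      ext ω i
      rcases i with i | i <;> simp [label, position_cons, X₁, X₂]
    calc ∫⁻ ω in {ω | alive τ t ω = Set.range (label (node l r))},
          F (fun i => position τ B (label (node l r) i) t ω) ∂P
        = ∫⁻ ω, G (τ [] ω) (B [] (τ [] ω).toNNReal ω) ω ω ∂P := by
          rw [← lintegral_indicator hAm]
          refine lintegral_congr fun ω => ?_
          have := congrFun hpos ω
          simp only [Set.indicator, Set.mem_ofPred_eq, alive_eq_node_iff h.lifetime_pos, this, hG,
            A₁, A₂, ite_and]
      _ = ∫⁻ s, ∫⁻ z, ∫⁻ ω, ∫⁻ ω', G s z ω ω' ∂P ∂P ∂(gaussianReal 0 s.toNNReal)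
            ∂(expMeasure 1) := by
          refine h.lintegral_branching ?_
          have hτ₁ : ∀ u, Measurable (fun ω : Coarse (sigmaOf τ B (Set.range (List.cons false))) =>
            τ (false :: u) ω) := fun u => measurable_lifetime_sigmaOf (Set.mem_range_self u)
          have hτ₂ : ∀ u, Measurable (fun ω : Coarse (sigmaOf τ B (Set.range (List.cons true))) =>
            τ (true :: u) ω) := fun u => measurable_lifetime_sigmaOf (Set.mem_range_self u)
          have hB₁ : ∀ u s, Measurable
            (fun ω : Coarse (sigmaOf τ B (Set.range (List.cons false))) => B (false :: u) s ω) :=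
            fun u s => measurable_motion_sigmaOf (Set.mem_range_self u) s
          have hB₂ : ∀ u s, Measurable
            (fun ω : Coarse (sigmaOf τ B (Set.range (List.cons true))) => B (true :: u) s ω) :=
            fun u s => measurable_motion_sigmaOf (Set.mem_range_self u) s
          set Ω₁ := Coarse (sigmaOf τ B (Set.range (List.cons false)))
          set Ω₂ := Coarse (sigmaOf τ B (Set.range (List.cons true)))
          have hm₁ : Measurable fun p : (ℝ × ℝ) × (Ω₁ × Ω₂) => (t - p.1.1, p.2.1) := by fun_prop
          have hm₂ : Measurable fun p : (ℝ × ℝ) × (Ω₁ × Ω₂) => (t - p.1.1, p.2.2) := by fun_prop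
          have hA₁ : MeasurableSet {p : (ℝ × ℝ) × (Ω₁ × Ω₂) | p.2.1 ∈ A₁ p.1.1} :=
            hm₁ (measurableSet_alive_eq hτ₁ (Set.range (label l)))
          have hA₂ : MeasurableSet {p : (ℝ × ℝ) × (Ω₁ × Ω₂) | p.2.2 ∈ A₂ p.1.1} :=
            hm₂ (measurableSet_alive_eq hτ₂ (Set.range (label r)))
          have hX₁ : ∀ i, Measurable fun p : (ℝ × ℝ) × (Ω₁ × Ω₂) => X₁ p.1.1 p.2.1 i := fun i =>
            (measurable_position hτ₁ hB₁ (fun u ω => h.continuous_motion _ ω) (label l i)).comp hm₁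
          have hX₂ : ∀ i, Measurable fun p : (ℝ × ℝ) × (Ω₁ × Ω₂) => X₂ p.1.1 p.2.2 i := fun i =>
            (measurable_position hτ₂ hB₂ (fun u ω => h.continuous_motion _ ω) (label r i)).comp hm₂
          have hE : Measurable fun p : (ℝ × ℝ) × (Ω₁ × Ω₂) =>
              F (Sum.elim (fun i => p.1.2 + X₁ p.1.1 p.2.1 i) (fun i => p.1.2 + X₂ p.1.1 p.2.2 i)) :=
            hF.comp (measurable_sumElim_shift.comp
              ((measurable_fst.snd.prodMk (measurable_pi_iff.2 hX₁)).prodMk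
                (measurable_pi_iff.2 hX₂)))
          exact (hE.indicator hA₂).indicator hA₁
      _ = ∫⁻ s, (Set.Iio t).indicator (fun s => ∫⁻ z, heat s z *
            ∫⁻ y, density l (t - s) y * ∫⁻ w, density r (t - s) w *
              F (Sum.elim (fun i => z + y i) (fun i => z + w i))) s ∂(expMeasure 1) := by
          refine lintegral_congr_ae ?_
          -- The induction hypothesis needs a positive remaining time `t - s`. The value `s = t` is
          -- negligible, and for `s > t` the subtrees are still empty.
          filter_upwards [ae_pos_expMeasure, expMeasure_absolutelyContinuous.ae_le
            (compl_mem_ae_iff.2 (measure_singleton t))] with s h0 hst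
          rcases lt_or_gt_of_ne (show s ≠ t from hst) with hs | hs
          · have hs' : 0 < t - s := sub_pos.2 hs
            rw [Set.indicator_of_mem (show s ∈ Set.Iio t from hs), gaussianReal_eq_withDensity_heat h0,
              lintegral_withDensity_eq_lintegral_mul_non_measurable _
                (continuous_heat s).measurable
                (Eventually.of_forall fun z => (heat_ne_top s z).lt_top)]
            refine lintegral_congr fun z => ?_
            have hFz : Measurable fun p : (Leaf l → ℝ) × (Leaf r → ℝ) =>
                F (Sum.elim (fun i => z + p.1 i) (fun i => z + p.2 i)) :=
              hF.comp (measurable_sumElim_shift.comp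
                (f := fun p : (Leaf l → ℝ) × (Leaf r → ℝ) => ((z, p.1), p.2)) (by fun_prop))
            have hA₁ : MeasurableSet (A₁ s) :=
              measurableSet_alive_eq_right (h.subtree false).measurable_lifetime _ _
            have hA₂ : MeasurableSet (A₂ s) :=
              measurableSet_alive_eq_right (h.subtree true).measurable_lifetime _ _
            have hin : ∀ ω, ∫⁻ ω', G s z ω ω' ∂P = (A₁ s).indicator (fun ω =>
                ∫⁻ w, density r (t - s) w *
                  F (Sum.elim (fun i => z + X₁ s ω i) (fun i => z + w i))) ω := by
              intro ω
              by_cases hω : ω ∈ A₁ s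
              · simp only [hG, Set.indicator_of_mem hω]
                rw [lintegral_indicator hA₂]
                exact hr (h.subtree true) hs' (hFz.comp (measurable_prodMk_left (x := X₁ s ω)))
              · simp [hG, Set.indicator_of_notMem hω]
            simp_rw [Pi.mul_apply, hin]
            rw [lintegral_indicator hA₁]
            congr 1
            refine hl (h.subtree false) hs' (F := fun y => ∫⁻ w, density r (t - s) w *
              F (Sum.elim (fun i => z + y i) (fun i => z + w i))) ?_
            exact Measurable.lintegral_prod_right'
              (((measurable_density_right r (t - s)).comp measurable_snd).mul hFz)
          · rw [Set.indicator_of_notMem (by simpa using hs.le)]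
            have hA : A₁ s = ∅ := by
              ext ω
              simp only [A₁, Set.mem_ofPred_eq, Set.mem_empty_iff_false, iff_false]
              rw [alive_of_neg (fun _ _ => h.lifetime_pos _ _) (by linarith)]
              exact (Set.range_nonempty (label l)).ne_empty.symm
            simp [hG, hA]
      _ = _ := by
          rw [lintegral_indicator measurableSet_Iio, lintegral_density_node_mul l r t hF]

end Regular

/-! ### Mean population size and non-explosion. -/

lemma setLIntegral_Ioc_pow_div_factorial (k : ℕ) {t : ℝ} (ht : 0 ≤ t) :
    ∫⁻ s in Set.Ioc 0 t, ENNReal.ofReal ((t - s) ^ k / k !) =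
      ENNReal.ofReal (t ^ (k + 1) / (k + 1)!) := by
  have hc : Continuous fun s : ℝ => (t - s) ^ k / k ! := by fun_prop
  rw [← ofReal_integral_eq_lintegral_ofReal hc.integrableOn_Ioc]
  · rw [← intervalIntegral.integral_of_le ht, intervalIntegral.integral_div,
      intervalIntegral.integral_comp_sub_left (fun x => x ^ k), integral_pow]
    congr 1
    rw [Nat.factorial_succ]
    push_cast
    field_simp
    simp
  · filter_upwards [ae_restrict_mem measurableSet_Ioc] with s hs
    have : 0 ≤ t - s := sub_nonneg.2 hs.2
    simp only [Pi.zero_apply]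
    positivity

namespace Regular

variable {Ω : Type*} [m0 : MeasurableSpace Ω] {P : Measure Ω} [IsProbabilityMeasure P]
  {τ : List Bool → Ω → ℝ} {B : List Bool → ℝ≥0 → Ω → ℝ}

omit [IsProbabilityMeasure P] in
lemma measurableSet_mem_alive_right (h : Regular P τ B) (u : List Bool) (t : ℝ) :
    MeasurableSet {ω | u ∈ alive τ t ω} :=
  measurable_prodMk_left (x := t) (measurableSet_mem_alive h.measurable_lifetime u)

lemma measure_cons_mem_alive (h : Regular P τ B) (b : Bool) (u : List Bool) (t : ℝ) :
    P {ω | b :: u ∈ alive τ t ω} =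
      ∫⁻ s, P {ω | u ∈ alive (fun v => τ (b :: v)) (t - s) ω} ∂(expMeasure 1) := by
  have hτ : ∀ u, Measurable (fun ω : Coarse (sigmaOf τ B (Set.range (List.cons b))) =>
    τ (b :: u) ω) := fun u => measurable_lifetime_sigmaOf (Set.mem_range_self u)
  have hA : MeasurableSet {p : ℝ × Coarse (sigmaOf τ B (Set.range (List.cons b))) |
      u ∈ alive (fun v => τ (b :: v)) (t - p.1) p.2} :=
    (show Measurable fun p : ℝ × Coarse (sigmaOf τ B (Set.range (List.cons b))) =>
      (t - p.1, p.2) by fun_prop) (measurableSet_mem_alive hτ u)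
  have := h.lintegral_first_split b (F := fun s =>
    {ω | u ∈ alive (fun v => τ (b :: v)) (t - s) ω}.indicator 1) (measurable_one.indicator hA)
  rw [← lintegral_indicator_one (h.measurableSet_mem_alive_right _ t)]
  refine Eq.trans (lintegral_congr fun ω => ?_) (this.trans (lintegral_congr fun s => ?_))
  · by_cases hm : u ∈ alive (fun v => τ (b :: v)) (t - τ [] ω) ω
    · rw [Set.indicator_of_mem (show ω ∈ {ω | b :: u ∈ alive τ t ω} from (cons_mem_alive τ).2 hm),
        Set.indicator_of_mem (by exact hm)]
    · rw [Set.indicator_of_notMem (by exact fun hc => hm ((cons_mem_alive τ).1 hc)),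
        Set.indicator_of_notMem (by exact hm)]
  · exact lintegral_indicator_one ((h.subtree b).measurableSet_mem_alive_right _ _)

/-- The generation of a particle alive at time `t` is Poisson distributed. -/
lemma measure_mem_alive (h : Regular P τ B) (u : List Bool) {t : ℝ} (ht : 0 ≤ t) :
    P {ω | u ∈ alive τ t ω} =
      ENNReal.ofReal (Real.exp (-t)) * ENNReal.ofReal (t ^ u.length / u.length !) := by
  induction u generalizing τ B t with
  | nil => simp [nil_mem_alive, ht, h.measure_lt_lifetime]
  | cons b u ih =>
    rw [h.measure_cons_mem_alive]
    calc ∫⁻ s, P {ω | u ∈ alive (fun v => τ (b :: v)) (t - s) ω} ∂(expMeasure 1)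
        = ∫⁻ s in Set.Iic t, ENNReal.ofReal (Real.exp (-(t - s))) *
            ENNReal.ofReal ((t - s) ^ u.length / u.length !) ∂(expMeasure 1) := by
          rw [← lintegral_indicator measurableSet_Iic]
          refine lintegral_congr fun s => ?_
          by_cases hs : s ≤ t
          · rw [Set.indicator_of_mem (by simpa using hs), ih (h.subtree b) (sub_nonneg.2 hs)]
          · rw [Set.indicator_of_notMem (by simpa using hs)]
            simp [alive_of_neg (fun v ω => h.lifetime_pos (b :: v) ω) (sub_neg.2 (not_le.1 hs))]
      -- The factors `exp (-s)` of the first lifetime and `exp (-(t - s))` of the subtree combine to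
      -- the constant `exp (-t)`.
      _ = ∫⁻ s in Set.Ioc 0 t, ENNReal.ofReal (Real.exp (-t)) *
            ENNReal.ofReal ((t - s) ^ u.length / u.length !) := by
          rw [setLIntegral_expMeasure measurableSet_Iic (by fun_prop), Set.inter_comm,
            Set.Ioi_inter_Iic]
          refine lintegral_congr fun s => ?_
          rw [← mul_assoc, ← ENNReal.ofReal_mul (Real.exp_pos _).le, ← Real.exp_add]
          congr 4
          ring
      _ = _ := by
          rw [lintegral_const_mul _ (by fun_prop), setLIntegral_Ioc_pow_div_factorial _ ht,
            List.length_cons]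

/-- Lifetimes have density at most one, so the probability is at most the volume of the simplex of
lifetimes with sum at most `t`. The factorial beats the `2 ^ k` words of generation `k`, which rules
out explosion. -/
lemma measure_birth_le (h : Regular P τ B) (u : List Bool) {t : ℝ} (ht : 0 ≤ t) :
    P {ω | birth τ u ω ≤ t} ≤ ENNReal.ofReal (t ^ u.length / u.length !) := by
  induction u generalizing τ B t with
  | nil => simpa using prob_le_one
  | cons b u ih =>
    have hτ : ∀ u, Measurable (fun ω : Coarse (sigmaOf τ B (Set.range (List.cons b))) =>
      τ (b :: u) ω) := fun u => measurable_lifetime_sigmaOf (Set.mem_range_self u)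
    have hb := measurable_birth hτ u
    have hA : MeasurableSet {p : ℝ × Coarse (sigmaOf τ B (Set.range (List.cons b))) |
        birth (fun v => τ (b :: v)) u p.2 ≤ t - p.1} :=
      measurableSet_le (hb.comp measurable_snd) (by fun_prop)
    have key := h.lintegral_first_split b (F := fun s =>
      {ω | birth (fun v => τ (b :: v)) u ω ≤ t - s}.indicator 1) (measurable_one.indicator hA)
    rw [← lintegral_indicator_one (measurableSet_le (measurable_birth h.measurable_lifetime _)
      measurable_const)]
    calc ∫⁻ ω, {ω | birth τ (b :: u) ω ≤ t}.indicator 1 ω ∂P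
        = ∫⁻ s, P {ω | birth (fun v => τ (b :: v)) u ω ≤ t - s} ∂(expMeasure 1) := by
          refine Eq.trans (lintegral_congr fun ω => ?_) (key.trans (lintegral_congr fun s => ?_))
          · simp [Set.indicator, birth_cons, le_sub_iff_add_le']
          · exact lintegral_indicator_one (measurableSet_le
              (measurable_birth (h.subtree b).measurable_lifetime _) measurable_const)
      _ ≤ ∫⁻ s in Set.Iic t, ENNReal.ofReal ((t - s) ^ u.length / u.length !)
            ∂(expMeasure 1) := by
          rw [← lintegral_indicator measurableSet_Iic]
          refine lintegral_mono fun s => ?_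
          by_cases hs : s ≤ t
          · rw [Set.indicator_of_mem (by simpa using hs)]
            exact ih (h.subtree b) (sub_nonneg.2 hs)
          · rw [Set.indicator_of_notMem (by simpa using hs), nonpos_iff_eq_zero]
            have : {ω | birth (fun v => τ (b :: v)) u ω ≤ t - s} = ∅ := by
              ext ω
              have := birth_nonneg (fun v ω => h.lifetime_pos (b :: v) ω) u ω
              simp only [Set.mem_ofPred_eq, Set.mem_empty_iff_false, iff_false, not_le]
              linarith
            rw [this, measure_empty]
      _ ≤ ∫⁻ s in Set.Ioc 0 t, ENNReal.ofReal ((t - s) ^ u.length / u.length !) := by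
          rw [setLIntegral_expMeasure measurableSet_Iic (by fun_prop), Set.inter_comm,
            Set.Ioi_inter_Iic]
          refine setLIntegral_mono' measurableSet_Ioc fun s hs => ?_
          refine mul_le_of_le_one_left zero_le ?_
          rw [ENNReal.ofReal_le_one, Real.exp_le_one_iff]
          linarith [hs.1]
      _ = _ := by rw [setLIntegral_Ioc_pow_div_factorial _ ht, List.length_cons]

end Regular

lemma tsum_length_eq (k : ℕ) (c : ℝ≥0∞) :
    ∑' _ : {u : List Bool // u.length = k}, c = 2 ^ k * c := by
  change ∑' _ : List.Vector Bool k, c = _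
  rw [tsum_fintype, Finset.sum_const, Finset.card_univ, nsmul_eq_mul, card_vector]
  simp

lemma tsum_list_length (f : ℕ → ℝ≥0∞) :
    ∑' u : List Bool, f u.length = ∑' k, 2 ^ k * f k := by
  rw [← (Equiv.sigmaFiberEquiv (List.length : List Bool → ℕ)).tsum_eq, ENNReal.tsum_sigma']
  refine tsum_congr fun k => ?_
  rw [← tsum_length_eq]
  exact tsum_congr fun u => congrArg f u.2

namespace Regular

variable {Ω : Type*} [m0 : MeasurableSpace Ω] {P : Measure Ω} [IsProbabilityMeasure P]
  {τ : List Bool → Ω → ℝ} {B : List Bool → ℝ≥0 → Ω → ℝ}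

/-- The expected size of the population. -/
lemma tsum_measure_mem_alive (h : Regular P τ B) {t : ℝ} (ht : 0 ≤ t) :
    ∑' u, P {ω | u ∈ alive τ t ω} = ENNReal.ofReal (Real.exp t) := by
  simp_rw [h.measure_mem_alive _ ht]
  rw [ENNReal.tsum_mul_left, tsum_list_length (fun k => ENNReal.ofReal (t ^ k / k !))]
  have hs : HasSum (fun k : ℕ => (2 * t) ^ k / k !) (Real.exp (2 * t)) := by
    rw [Real.exp_eq_exp_ℝ]
    exact NormedSpace.expSeries_div_hasSum_exp (2 * t)
  -- The `2 ^ k` words of length `k` turn the sum into `exp (-t) * exp (2 * t)`.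
  have hk : ∀ k : ℕ, 2 ^ k * ENNReal.ofReal (t ^ k / k !) = ENNReal.ofReal ((2 * t) ^ k / k !) := by
    intro k
    rw [mul_pow, mul_div_assoc, ENNReal.ofReal_mul (by positivity), ENNReal.ofReal_pow (by norm_num)]
    simp
  simp_rw [hk]
  rw [← ENNReal.ofReal_tsum_of_nonneg (fun k => by positivity) hs.summable, hs.tsum_eq,
    ← ENNReal.ofReal_mul (Real.exp_pos _).le, ← Real.exp_add]
  congr 2
  ring

/-- Almost surely the population does not explode, so the particles alive form a genealogy. -/
lemma ae_exists_alive_eq (h : Regular P τ B) {t : ℝ} (ht : 0 ≤ t) :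
    ∀ᵐ ω ∂P, ∃ T, alive τ t ω = Set.range (Genealogy.label T) := by
  -- If the population is not a genealogy, every generation `d` has a member born by time `t`; the
  -- bound is a union bound over its `2 ^ d` words.
  have hd : ∀ d : ℕ, P {ω | ¬ ∃ T, alive τ t ω = Set.range (Genealogy.label T)} ≤
      ENNReal.ofReal ((2 * t) ^ d / d !) := by
    intro d
    calc P {ω | ¬ ∃ T, alive τ t ω = Set.range (Genealogy.label T)}
        ≤ P (⋃ u : {u : List Bool // u.length = d}, {ω | birth τ u ω ≤ t}) := by
          refine measure_mono fun ω hω => ?_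
          by_contra hcon
          simp only [Set.mem_iUnion, Set.mem_ofPred_eq, not_exists, not_le] at hcon
          exact hω (exists_alive_eq_range_label d h.lifetime_pos ht fun u hu => hcon ⟨u, hu⟩)
      _ ≤ ∑' u : {u : List Bool // u.length = d}, P {ω | birth τ u ω ≤ t} := measure_iUnion_le _
      _ ≤ ∑' _ : {u : List Bool // u.length = d}, ENNReal.ofReal (t ^ d / d !) := by
          refine ENNReal.tsum_le_tsum fun u => ?_
          have := h.measure_birth_le u ht
          rwa [u.2] at this
      _ = _ := by
          rw [tsum_length_eq, mul_pow, mul_div_assoc, ENNReal.ofReal_mul (by positivity),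
            ENNReal.ofReal_pow (by norm_num)]
          simp
  rw [ae_iff, ← nonpos_iff_eq_zero]
  refine ge_of_tendsto' (f := fun d : ℕ => ENNReal.ofReal ((2 * t) ^ d / d !)) (x := atTop) ?_ hd
  have := ENNReal.tendsto_ofReal (FloorSemiring.tendsto_pow_div_factorial_atTop (2 * t))
  simpa using this

end Regular

/-! ### Enumerations of the particles and the continuous density. -/

namespace Genealogy

/-- Every strict ancestor of a leaf has a second child, whose subtree holds at least one further
leaf. -/
lemma length_label_lt (T : Genealogy) (i : Leaf T) : (label T i).length < Fintype.card (Leaf T) := by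
  induction T with
  | leaf => exact Fintype.card_pos
  | node l r hl hr =>
    have hc : Fintype.card (Leaf (node l r)) = Fintype.card (Leaf l) + Fintype.card (Leaf r) :=
      Fintype.card_sum
    have h1 : 0 < Fintype.card (Leaf l) := Fintype.card_pos
    have h2 : 0 < Fintype.card (Leaf r) := Fintype.card_pos
    rcases i with i | i
    · have := hl i
      simp only [label, List.length_cons]
      omega
    · have := hr i
      simp only [label, List.length_cons]
      omega

end Genealogy

instance {n : ℕ} : Countable (Fin n ↪ List Bool) :=
  (DFunLike.coe_injective (F := Fin n ↪ List Bool)).countable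

/-- The enumerations of the leaves of a genealogy. -/
def IsEnumeration {n : ℕ} (e : Fin n ↪ List Bool) : Prop :=
  ∃ T, Set.range e = Set.range (label T)

lemma IsEnumeration.exists_equiv {n : ℕ} {e : Fin n ↪ List Bool} (h : IsEnumeration e) :
    ∃ (T : Genealogy) (σ : Fin n ≃ Leaf T), ∀ i, e i = label T (σ i) := by
  obtain ⟨T, hT⟩ := h
  refine ⟨T, ((Equiv.ofInjective e e.injective).trans (Equiv.setCongr hT)).trans
    (Equiv.ofInjective _ (label_injective T)).symm, fun i => ?_⟩
  have := Equiv.apply_ofInjective_symm (label_injective T) ⟨e i, hT ▸ Set.mem_range_self i⟩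
  exact this.symm

/-- By `length_label_lt` only words of length at most `n` occur. Finiteness lets continuity and the
heat kernel bounds pass to the sum over enumerations. -/
lemma finite_setOf_isEnumeration (n : ℕ) : {e : Fin n ↪ List Bool | IsEnumeration e}.Finite := by
  have hfin : {f : Fin n → List Bool | ∀ i, f i ∈ {u : List Bool | u.length ≤ n}}.Finite :=
    Set.Finite.pi' fun _ => List.finite_length_le Bool n
  refine (hfin.preimage (DFunLike.coe_injective (F := Fin n ↪ List Bool)).injOn).subset ?_
  intro e he i
  obtain ⟨T, σ, h⟩ := IsEnumeration.exists_equiv he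
  have := length_label_lt T (σ i)
  rw [← Fintype.card_congr σ, Fintype.card_fin] at this
  rw [Set.mem_ofPred_eq, h]
  exact this.le

/-- A density of the positions of `n` particles which is bounded by the heat kernel of each of
them. -/
structure IsHeatBounded {n : ℕ} (t : ℝ) (G : (Fin n → ℝ) → ℝ≥0∞) : Prop where
  continuous : Continuous G
  exists_le : ∃ C : ℝ≥0∞, C ≠ ∞ ∧ ∀ x i, G x ≤ C * heat t (x i)
  lintegral_coord : ∀ (i : Fin n) (f : ℝ → ℝ≥0∞), Measurable f →
    ∫⁻ x, G x * f (x i) = (∫⁻ x, G x) * ∫⁻ y, heat t y * f y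

namespace IsHeatBounded

variable {n : ℕ} {t : ℝ}

lemma zero : IsHeatBounded t (0 : (Fin n → ℝ) → ℝ≥0∞) where
  continuous := continuous_zero
  exists_le := ⟨0, ENNReal.zero_ne_top, by simp⟩
  lintegral_coord := by simp

lemma sum {ι : Type*} (s : Finset ι) {G : ι → (Fin n → ℝ) → ℝ≥0∞}
    (h : ∀ i, IsHeatBounded t (G i)) : IsHeatBounded t (fun x => ∑ i ∈ s, G i x) where
  continuous := continuous_finsetSum _ fun i _ => (h i).continuous
  exists_le := by
    choose C hC hle using fun i => (h i).exists_le
    refine ⟨∑ i ∈ s, C i, by simp [hC], fun x j => ?_⟩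
    rw [Finset.sum_mul]
    exact Finset.sum_le_sum fun i _ => hle i x j
  lintegral_coord j f hf := by
    have hm : ∀ i ∈ s, Measurable fun x => G i x * f (x j) := fun i _ =>
      (h i).continuous.measurable.fun_mul (hf.comp (measurable_pi_apply j))
    simp_rw [Finset.sum_mul]
    rw [lintegral_finsetSum _ fun i _ => (h i).continuous.measurable, Finset.sum_mul,
      lintegral_finsetSum _ hm]
    exact Finset.sum_congr rfl fun i _ => (h i).lintegral_coord j f hf

lemma const_mul {c : ℝ≥0∞} (hc : c ≠ ∞) {G : (Fin n → ℝ) → ℝ≥0∞} (h : IsHeatBounded t G) :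
    IsHeatBounded t (fun x => c * G x) where
  continuous := (ENNReal.continuous_const_mul hc).comp h.continuous
  exists_le := by
    obtain ⟨C, hC, hle⟩ := h.exists_le
    refine ⟨c * C, ENNReal.mul_ne_top hc hC, fun x i => ?_⟩
    rw [mul_assoc]
    exact mul_le_mul_right (hle x i) c
  lintegral_coord i f hf := by
    simp_rw [mul_assoc]
    rw [lintegral_const_mul' _ _ hc, lintegral_const_mul' _ _ hc, h.lintegral_coord i f hf,
      mul_assoc]

end IsHeatBounded

namespace Regular

variable {Ω : Type*} [m0 : MeasurableSpace Ω] {P : Measure Ω} [IsProbabilityMeasure P]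
  {τ : List Bool → Ω → ℝ} {B : List Bool → ℝ≥0 → Ω → ℝ}

/-- Relabelling the leaves by `Fin n` permutes coordinates, which preserves volume, so the
properties of `density T t` carry over. -/
lemma exists_density_of_isEnumeration (h : Regular P τ B) {n : ℕ} {e : Fin n ↪ List Bool}
    (he : IsEnumeration e) {t : ℝ} (ht : 0 < t) :
    ∃ G : (Fin n → ℝ) → ℝ≥0∞, IsHeatBounded t G ∧
      (P.restrict {ω | alive τ t ω = Set.range e}).map (fun ω i => position τ B (e i) t ω) =
        volume.withDensity G := by
  obtain ⟨T, σ, hσ⟩ := he.exists_equiv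
  have hrange : Set.range e = Set.range (label T) := by
    rw [← σ.surjective.range_comp]
    exact congrArg Set.range (funext hσ)
  have hmp := volume_measurePreserving_piCongrLeft (fun _ : Leaf T => ℝ) σ
  have hcoe : ∀ x : Fin n → ℝ, MeasurableEquiv.piCongrLeft (fun _ : Leaf T => ℝ) σ x =
      fun j => x (σ.symm j) := fun x => by
    ext j
    obtain ⟨i, rfl⟩ := σ.surjective j
    rw [MeasurableEquiv.coe_piCongrLeft, Equiv.piCongrLeft_apply_apply, Equiv.symm_apply_apply]
  have hint : ∀ F : (Leaf T → ℝ) → ℝ≥0∞, ∫⁻ x : Fin n → ℝ, F (fun j => x (σ.symm j)) =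
      ∫⁻ y, F y := fun F => by
    rw [← hmp.lintegral_comp_emb (MeasurableEquiv.measurableEmbedding _) F]
    simp_rw [hcoe]
  have hcomp : Continuous fun (x : Fin n → ℝ) (j : Leaf T) => x (σ.symm j) := by fun_prop
  refine ⟨fun x => density T t (fun j => x (σ.symm j)), ⟨(continuous_density T ht).comp hcomp,
    ?_, ?_⟩, ?_⟩
  · obtain ⟨C, hC, hle⟩ := exists_density_le T t
    refine ⟨C, hC, fun x i => ?_⟩
    simpa using hle t ht le_rfl (fun j => x (σ.symm j)) (σ i)
  · intro i f hf
    have := hint fun y => density T t y * f (y (σ i))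
    simp only [Equiv.symm_apply_apply] at this
    rw [this, hint (density T t), lintegral_density_mul_coord T ht (σ i) hf]
  · ext A hA
    rw [withDensity_apply _ hA, ← lintegral_indicator hA,
      ← lintegral_indicator_one hA, lintegral_map (measurable_one.indicator hA)
        (h.measurable_positions e t), hrange]
    have hF : Measurable fun y : Leaf T → ℝ =>
        A.indicator (1 : (Fin n → ℝ) → ℝ≥0∞) (fun i => y (σ i)) :=
      (measurable_one.indicator hA).comp (by fun_prop)
    have key := h.setLIntegral_positions_eq T ht hF
    simp_rw [← hσ] at key
    rw [key, ← hint]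
    refine lintegral_congr fun x => ?_
    simp only [Equiv.symm_apply_apply]
    by_cases hx : x ∈ A <;> simp [hx]

/-- The law of `n` particles has a continuous density. -/
lemma exists_density (h : Regular P τ B) (n : ℕ) {t : ℝ} (ht : 0 < t) :
    ∃ G : (Fin n → ℝ) → ℝ≥0∞, IsHeatBounded t G ∧
      particleLaw P τ B n t = volume.withDensity G := by
  classical
  have hex : ∀ e : Fin n ↪ List Bool, ∃ G : (Fin n → ℝ) → ℝ≥0∞, IsHeatBounded t G ∧
      (P.restrict {ω | alive τ t ω = Set.range e}).map (fun ω i => position τ B (e i) t ω) =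
        volume.withDensity G ∧ (¬ IsEnumeration e → G = 0) := by
    intro e
    by_cases he : IsEnumeration e
    · obtain ⟨G, h1, h2⟩ := h.exists_density_of_isEnumeration he ht
      exact ⟨G, h1, h2, fun hn => absurd he hn⟩
    · refine ⟨0, IsHeatBounded.zero, ?_, fun _ => rfl⟩
      -- The population is almost surely a genealogy, so any other enumeration has mass zero; taking
      -- `G = 0` there reduces the sum to a finite one.
      have : P {ω | alive τ t ω = Set.range e} = 0 := by
        refine measure_mono_null (fun ω hω => ?_) (ae_iff.1 (h.ae_exists_alive_eq ht.le))
        rintro ⟨T, hT⟩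
        have hω' : alive τ t ω = Set.range e := hω
        exact he ⟨T, hω' ▸ hT⟩
      rw [Measure.restrict_eq_zero.2 this, Measure.map_zero, withDensity_zero]
  choose G hG hlaw hzero using hex
  set s := (finite_setOf_isEnumeration n).toFinset
  refine ⟨fun x => (n ! : ℝ≥0∞)⁻¹ * ∑ e ∈ s, G e x, (IsHeatBounded.sum s hG).const_mul
    (ENNReal.inv_ne_top.2 (by exact_mod_cast (Nat.factorial_ne_zero n))), ?_⟩
  have hsum : (fun x => ∑ e ∈ s, G e x) = ∑' e, G e := by
    rw [tsum_eq_sum (s := s)]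
    · ext x; simp
    · intro e he
      exact hzero e (by simpa [s] using he)
  unfold particleLaw
  simp_rw [hlaw]
  have hsm := withDensity_smul (μ := (volume : Measure (Fin n → ℝ))) (n ! : ℝ≥0∞)⁻¹
    (IsHeatBounded.sum s hG).continuous.measurable
  refine Eq.trans ?_ hsm.symm
  rw [hsum, withDensity_tsum fun e => (hG e).continuous.measurable]

end Regular

/-! ### Counting enumerations: the weighted masses sum to the mean population size. -/

section Counting

/-- Enumerations of a finite set by `Fin m`. -/
def enumerationEquiv {α : Type*} (S : Set α) (m : ℕ) :
    {e : Fin m ↪ α // S = Set.range e} ≃ (Fin m ≃ S) where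
  toFun e := (Equiv.ofInjective e.1 e.1.injective).trans (Equiv.setCongr e.2.symm)
  invFun σ := ⟨σ.toEmbedding.trans (Function.Embedding.subtype _), by
    ext x
    constructor
    · intro hx
      exact ⟨σ.symm ⟨x, hx⟩, by simp⟩
    · rintro ⟨i, rfl⟩
      exact (σ i).2⟩
  left_inv e := by ext; rfl
  right_inv σ := by ext; rfl

lemma tsum_enumerations {α : Type*} {S : Set α} (hS : S.Finite) (m : ℕ) :
    ∑' _ : {e : Fin m ↪ α // S = Set.range e}, (1 : ℝ≥0∞) =
      if m = S.ncard then (m ! : ℝ≥0∞) else 0 := by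
  classical
  have := hS.fintype
  rw [(enumerationEquiv S m).tsum_eq (fun _ => (1 : ℝ≥0∞)), tsum_fintype, Finset.sum_const,
    Finset.card_univ, nsmul_one]
  split_ifs with hm
  · have e : Fin m ≃ S := Fintype.equivOfCardEq (by
      rw [Fintype.card_fin, hm, Set.ncard_eq_toFinset_card', Set.toFinset_card])
    rw [Fintype.card_equiv e, Fintype.card_fin]
  · have : IsEmpty (Fin m ≃ S) := ⟨fun e => hm (by
      rw [Set.ncard_eq_toFinset_card', Set.toFinset_card, ← Fintype.card_congr e,
        Fintype.card_fin])⟩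
    simp

/-- Only `n + 1 = S.ncard` contributes. Its `(n + 1)!` enumerations cancel the weight of a random
numbering and leave the cardinality of `S`. -/
lemma tsum_weighted_enumerations {α : Type*} {S : Set α} (hS : S.Finite) (hne : S.Nonempty) :
    ∑' n : ℕ, ((n : ℝ≥0∞) + 1) * (((n + 1)! : ℝ≥0∞)⁻¹ *
      ∑' e : Fin (n + 1) ↪ α, {e : Fin (n + 1) ↪ α | S = Set.range e}.indicator 1 e) =
    ∑' u, S.indicator 1 u := by
  have hpos : 0 < S.ncard := (Set.ncard_pos hS).2 hne
  have hR : ∑' u, S.indicator (1 : α → ℝ≥0∞) u = S.ncard := by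
    have := hS.fintype
    rw [← tsum_subtype S (1 : α → ℝ≥0∞), tsum_fintype]
    simp only [Pi.one_apply, Finset.sum_const, Finset.card_univ, nsmul_one,
      Set.fintypeCard_eq_ncard]
  have hL : ∀ n : ℕ, ∑' e : Fin (n + 1) ↪ α,
      {e : Fin (n + 1) ↪ α | S = Set.range e}.indicator (1 : (Fin (n + 1) ↪ α) → ℝ≥0∞) e =
      if n + 1 = S.ncard then ((n + 1)! : ℝ≥0∞) else 0 := by
    intro n
    rw [← tsum_enumerations hS, ← tsum_subtype]
    rfl
  simp_rw [hL, hR]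
  rw [tsum_eq_single (S.ncard - 1)]
  · rw [if_pos (by omega), ENNReal.inv_mul_cancel (by exact_mod_cast Nat.factorial_ne_zero _)
      (ENNReal.natCast_ne_top _), mul_one]
    exact_mod_cast Nat.succ_pred_eq_of_pos hpos
  · intro n hn
    rw [if_neg (by omega)]
    simp

end Counting

namespace Regular

variable {Ω : Type*} [m0 : MeasurableSpace Ω] {P : Measure Ω} [IsProbabilityMeasure P]
  {τ : List Bool → Ω → ℝ} {B : List Bool → ℝ≥0 → Ω → ℝ}

omit [IsProbabilityMeasure P] in
lemma measurableSet_alive_eq_range (h : Regular P τ B) {n : ℕ} (e : Fin n ↪ List Bool) (t : ℝ) :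
    MeasurableSet {ω | alive τ t ω = Set.range e} :=
  measurableSet_alive_eq_right h.measurable_lifetime _ _

omit [IsProbabilityMeasure P] in
lemma particleLaw_univ (h : Regular P τ B) (n : ℕ) (t : ℝ) :
    particleLaw P τ B n t Set.univ = (n ! : ℝ≥0∞)⁻¹ *
      ∑' e : Fin n ↪ List Bool, P {ω | alive τ t ω = Set.range e} := by
  simp only [particleLaw, Measure.smul_apply, smul_eq_mul, Measure.sum_apply _ MeasurableSet.univ]
  congr 1
  refine tsum_congr fun e => ?_
  rw [Measure.map_apply (h.measurable_positions e t) MeasurableSet.univ]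
  simp

/-- The mean number of particles is `exp t`. -/
lemma tsum_mul_particleLaw_univ (h : Regular P τ B) {t : ℝ} (ht : 0 ≤ t) :
    ∑' n : ℕ, ((n : ℝ≥0∞) + 1) * particleLaw P τ B (n + 1) t Set.univ =
      ENNReal.ofReal (Real.exp t) := by
  have hm : ∀ n : ℕ, ∀ e : Fin (n + 1) ↪ List Bool, Measurable
      ({ω | alive τ t ω = Set.range e}.indicator (1 : Ω → ℝ≥0∞)) := fun n e =>
    measurable_one.indicator (h.measurableSet_alive_eq_range e t)
  have hm' : ∀ n : ℕ, Measurable fun ω => ∑' e : Fin (n + 1) ↪ List Bool,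
      {ω | alive τ t ω = Set.range e}.indicator (1 : Ω → ℝ≥0∞) ω := fun n =>
    Measurable.tsum (hm n)
  calc ∑' n : ℕ, ((n : ℝ≥0∞) + 1) * particleLaw P τ B (n + 1) t Set.univ
      = ∑' n : ℕ, ((n : ℝ≥0∞) + 1) * (((n + 1)! : ℝ≥0∞)⁻¹ * ∑' e : Fin (n + 1) ↪ List Bool,
          ∫⁻ ω, {ω | alive τ t ω = Set.range e}.indicator 1 ω ∂P) := by
        refine tsum_congr fun n => ?_
        rw [h.particleLaw_univ]
        simp_rw [lintegral_indicator_one (h.measurableSet_alive_eq_range _ t)]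
    _ = ∫⁻ ω, ∑' n : ℕ, ((n : ℝ≥0∞) + 1) * (((n + 1)! : ℝ≥0∞)⁻¹ *
          ∑' e : Fin (n + 1) ↪ List Bool,
            {ω | alive τ t ω = Set.range e}.indicator 1 ω) ∂P := by
        rw [lintegral_tsum fun n => (((hm' n).const_mul _).const_mul _).aemeasurable]
        refine tsum_congr fun n => ?_
        rw [lintegral_const_mul _ ((hm' n).const_mul _), lintegral_const_mul _ (hm' n),
          lintegral_tsum fun e => (hm n e).aemeasurable]
    _ = ∫⁻ ω, ∑' u, {ω | u ∈ alive τ t ω}.indicator 1 ω ∂P := by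
        refine lintegral_congr_ae ?_
        filter_upwards [h.ae_exists_alive_eq ht] with ω hω
        obtain ⟨T, hT⟩ := hω
        have := tsum_weighted_enumerations (S := alive τ t ω) (hT ▸ Set.finite_range _)
          (hT ▸ Set.range_nonempty _)
        exact this
    _ = _ := by
        rw [lintegral_tsum fun u =>
          (measurable_one.indicator (h.measurableSet_mem_alive_right u t)).aemeasurable,
          ← h.tsum_measure_mem_alive ht]
        exact tsum_congr fun u => lintegral_indicator_one (h.measurableSet_mem_alive_right u t)

end Regular

/-! ### Pointwise marginals of heat-bounded densities. -/

section Marginal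

variable {n : ℕ} {t : ℝ}

lemma lintegral_snoc {F : (Fin (n + 1) → ℝ) → ℝ≥0∞} (hF : Measurable F) :
    ∫⁻ x, F x = ∫⁻ x : ℝ, ∫⁻ y : Fin n → ℝ, F (Fin.snoc (α := fun _ => ℝ) y x) := by
  have h := (volume_preserving_piFinSuccAbove (fun _ : Fin (n + 1) => ℝ) (Fin.last n)).symm
  rw [← h.lintegral_comp hF, Measure.volume_eq_prod]
  refine (lintegral_prod _ (hF.comp h.measurable).aemeasurable).trans ?_
  refine lintegral_congr fun x => lintegral_congr fun y => congrArg F ?_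
  exact Fin.insertNth_last (α := fun _ => ℝ) x y

lemma measurable_snoc :
    Measurable fun p : ℝ × (Fin n → ℝ) => Fin.snoc (α := fun _ => ℝ) p.2 p.1 := by
  refine measurable_pi_iff.2 fun i => ?_
  refine Fin.lastCases ?_ (fun i => ?_) i
  · simpa using measurable_fst
  · simp only [Fin.snoc_castSucc]
    fun_prop

lemma continuous_snoc (y : Fin n → ℝ) :
    Continuous fun x : ℝ => Fin.snoc (α := fun _ => ℝ) y x := by
  refine continuous_pi fun i => ?_
  refine Fin.lastCases ?_ (fun i => ?_) i
  · simp only [Fin.snoc_last]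
    fun_prop
  · simpa using continuous_const

lemma continuous_snoc_left (x : ℝ) :
    Continuous fun y : Fin n → ℝ => Fin.snoc (α := fun _ => ℝ) y x := by
  refine continuous_pi fun i => ?_
  refine Fin.lastCases ?_ (fun i => ?_) i
  · simpa using continuous_const
  · simpa using continuous_apply i

/-- The bounds by the individual heat kernels yield a bound which is integrable in all but one
coordinate. -/
lemma le_prod_of_forall_le_heat (ht : 0 < t) {C : ℝ≥0∞}
    {G : (Fin (n + 1) → ℝ) → ℝ≥0∞} (h : ∀ x i, G x ≤ C * heat t (x i)) (y : Fin n → ℝ) (x : ℝ) :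
    G (Fin.snoc (α := fun _ => ℝ) y x) ≤ C * heatMax t *
      ENNReal.ofReal (∏ i, Real.exp (-(1 / (2 * t * (n + 1))) * y i ^ 2)) := by
  set w : Fin (n + 1) → ℝ := Fin.snoc (α := fun _ => ℝ) y x
  -- The largest square is at least the average. The Gaussian bound in that coordinate therefore
  -- decays in all of them, with rate divided by `n + 1`; dropping the square of `x` makes the
  -- majorant independent of `x`.
  obtain ⟨j, -, hj⟩ : ∃ j ∈ (Finset.univ : Finset (Fin (n + 1))),
      (∑ i, w i ^ 2) / (n + 1) ≤ w j ^ 2 := by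
    refine Finset.exists_le_of_sum_le Finset.univ_nonempty ?_
    rw [Finset.sum_const, Finset.card_univ, Fintype.card_fin, nsmul_eq_mul]
    push_cast
    rw [mul_div_cancel₀ _ (by positivity)]
  have hsum : ∑ i, y i ^ 2 ≤ ∑ i, w i ^ 2 := by
    rw [Fin.sum_univ_castSucc]
    simp [w, sq_nonneg]
  refine (h w j).trans ?_
  rw [mul_assoc]
  refine mul_le_mul_right ?_ C
  rw [heat, heatMax, ← ENNReal.ofReal_mul (by positivity), ← Real.exp_sum, ← Finset.mul_sum]
  refine ENNReal.ofReal_le_ofReal ?_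
  unfold heatR
  gcongr
  have h1 : (∑ i, y i ^ 2) / (n + 1) ≤ w j ^ 2 := le_trans (by gcongr) hj
  have h2 : -w j ^ 2 / (2 * t) ≤ -((∑ i, y i ^ 2) / (n + 1)) / (2 * t) := by gcongr
  refine h2.trans_eq ?_
  field_simp

lemma lintegral_ofReal_prod_exp_ne_top {b : ℝ} (hb : 0 < b) :
    ∫⁻ y : Fin n → ℝ, ENNReal.ofReal (∏ i, Real.exp (-b * y i ^ 2)) ≠ ∞ := by
  have h : Integrable fun y : Fin n → ℝ => ∏ i, Real.exp (-b * y i ^ 2) :=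
    Integrable.fintype_prod (f := fun _ x => Real.exp (-b * x ^ 2))
      fun _ => integrable_exp_neg_mul_sq hb
  exact h.lintegral_lt_top.ne

/-- The marginals of the density are the heat kernel, at every point. -/
lemma IsHeatBounded.lintegral_snoc_eq {G : (Fin (n + 1) → ℝ) → ℝ≥0∞} (h : IsHeatBounded t G)
    (ht : 0 < t) (hfin : ∫⁻ x, G x ≠ ∞) (x : ℝ) :
    ∫⁻ y : Fin n → ℝ, G (Fin.snoc (α := fun _ => ℝ) y x) = (∫⁻ x, G x) * heat t x := by
  obtain ⟨C, hC, hle⟩ := h.exists_le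
  have hbd := le_prod_of_forall_le_heat ht hle
  have hmeas : Measurable fun p : ℝ × (Fin n → ℝ) => G (Fin.snoc (α := fun _ => ℝ) p.2 p.1) :=
    h.continuous.measurable.comp measurable_snoc
  -- `lintegral_coord` identifies the two sides only almost everywhere; continuity of both in `x`
  -- makes the identity hold at every point.
  have hcont : Continuous fun x : ℝ => ∫⁻ y : Fin n → ℝ, G (Fin.snoc (α := fun _ => ℝ) y x) := by
    refine continuous_iff_continuousAt.2 fun x => ?_
    refine tendsto_lintegral_filter_of_dominated_convergence (fun y : Fin n → ℝ => C * heatMax t *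
      ENNReal.ofReal (∏ i, Real.exp (-(1 / (2 * t * (n + 1))) * y i ^ 2))) ?_ ?_ ?_ ?_
    · exact Eventually.of_forall fun x => hmeas.comp measurable_prodMk_left
    · exact Eventually.of_forall fun x => Eventually.of_forall fun y => hbd y x
    · have hK : C * heatMax t ≠ ∞ := ENNReal.mul_ne_top hC (heatMax_ne_top t)
      rw [lintegral_const_mul' _ _ hK]
      exact ENNReal.mul_ne_top hK (lintegral_ofReal_prod_exp_ne_top (by positivity))
    · exact Eventually.of_forall fun y => (h.continuous.comp (continuous_snoc y)).tendsto x
  have hcont' : Continuous fun x : ℝ => (∫⁻ x, G x) * heat t x :=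
    (ENNReal.continuous_const_mul hfin).comp (continuous_heat t)
  have hae : (fun x : ℝ => ∫⁻ y : Fin n → ℝ, G (Fin.snoc (α := fun _ => ℝ) y x)) =ᵐ[volume]
      fun x : ℝ => (∫⁻ x, G x) * heat t x := by
    refine ae_eq_of_forall_setLIntegral_eq_of_sigmaFinite hcont.measurable hcont'.measurable
      fun A hA _ => ?_
    have hf : Measurable (A.indicator (1 : ℝ → ℝ≥0∞)) := measurable_one.indicator hA
    have key := h.lintegral_coord (Fin.last n) (A.indicator 1) hf
    have hm : Measurable fun x : Fin (n + 1) → ℝ => G x * A.indicator 1 (x (Fin.last n)) :=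
      h.continuous.measurable.fun_mul (hf.comp (measurable_pi_apply _))
    rw [lintegral_snoc hm] at key
    rw [← lintegral_indicator hA, ← lintegral_indicator hA]
    refine Eq.trans (lintegral_congr fun x => ?_) (key.trans ?_)
    · by_cases hx : x ∈ A <;> simp [hx]
    · rw [← lintegral_const_mul' _ _ hfin]
      refine lintegral_congr fun x => ?_
      by_cases hx : x ∈ A <;> simp [hx]
  exact congrFun ((hcont.ae_eq_iff_eq volume hcont').1 hae) x

end Marginal

/-! ### Invariance under almost sure modification. -/

section Transfer

variable {Ω : Type*} [MeasurableSpace Ω] {P : Measure Ω}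
  {τ τ' : List Bool → Ω → ℝ} {B B' : List Bool → ℝ≥0 → Ω → ℝ}

lemma particleLaw_congr (h : ∀ᵐ ω ∂P, ∀ u, τ u ω = τ' u ω ∧ ∀ s, B u s ω = B' u s ω) (n : ℕ)
    (t : ℝ) : particleLaw P τ B n t = particleLaw P τ' B' n t := by
  have hb : ∀ᵐ ω ∂P, ∀ u, birth τ u ω = birth τ' u ω := by
    filter_upwards [h] with ω hω u
    exact Finset.sum_congr rfl fun k _ => (hω _).1
  have ha : ∀ᵐ ω ∂P, alive τ t ω = alive τ' t ω := by
    filter_upwards [h, hb] with ω hω hb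
    ext u
    simp only [alive, Set.mem_ofPred_eq, hb, (hω u).1]
  unfold particleLaw
  congr 2
  ext1 e
  have h1 : {ω | alive τ t ω = Set.range e} =ᵐ[P] {ω | alive τ' t ω = Set.range e} := by
    filter_upwards [ha] with ω hω
    exact congrArg (fun S => S = Set.range e) hω
  rw [Measure.restrict_congr_set h1]
  refine Measure.map_congr (ae_restrict_of_ae ?_)
  filter_upwards [h, hb] with ω hω hb
  ext i
  simp only [position, hb, (hω _).1, (hω _).2]

lemma concentrationMeasure_congr
    (h : ∀ᵐ ω ∂P, ∀ u, τ u ω = τ' u ω ∧ ∀ s, B u s ω = B' u s ω) (t : ℝ) :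
    concentrationMeasure P τ B t = concentrationMeasure P τ' B' t := by
  simp only [concentrationMeasure, particleLaw_congr h]

end Transfer

/-! ### The concentration measure and the closed form of the concentration. -/

namespace Regular

variable {Ω : Type*} [m0 : MeasurableSpace Ω] {P : Measure Ω} [IsProbabilityMeasure P]
  {τ : List Bool → Ω → ℝ} {B : List Bool → ℝ≥0 → Ω → ℝ}

lemma particleLaw_univ_ne_top (h : Regular P τ B) {t : ℝ} (ht : 0 ≤ t) (n : ℕ) :
    particleLaw P τ B (n + 1) t Set.univ ≠ ∞ := by
  intro htop
  have h1 := ENNReal.le_tsum (f := fun n : ℕ =>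
    ((n : ℝ≥0∞) + 1) * particleLaw P τ B (n + 1) t Set.univ) n
  rw [h.tsum_mul_particleLaw_univ ht, htop, ENNReal.mul_top (by simp)] at h1
  exact absurd h1 (by simp)

/-- The law of the last of `n + 1` particles. -/
lemma map_last_particleLaw (h : Regular P τ B) {t : ℝ} (ht : 0 < t) (n : ℕ) :
    (particleLaw P τ B (n + 1) t).map (fun y => y (Fin.last n)) =
      particleLaw P τ B (n + 1) t Set.univ • volume.withDensity (heat t) := by
  obtain ⟨G, hG, hlaw⟩ := h.exists_density (n + 1) ht
  have hmass : particleLaw P τ B (n + 1) t Set.univ = ∫⁻ x, G x := by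
    rw [hlaw, withDensity_apply _ MeasurableSet.univ, Measure.restrict_univ]
  ext A hA
  have hf : Measurable (A.indicator (1 : ℝ → ℝ≥0∞)) := measurable_one.indicator hA
  have hf' : Measurable fun y : Fin (n + 1) → ℝ =>
      A.indicator (1 : ℝ → ℝ≥0∞) (y (Fin.last n)) := hf.comp (measurable_pi_apply _)
  rw [Measure.smul_apply, smul_eq_mul, withDensity_apply _ hA, hmass, ← lintegral_indicator hA,
    ← lintegral_indicator_one hA, lintegral_map hf (measurable_pi_apply _), hlaw,
    lintegral_withDensity_eq_lintegral_mul _ hG.continuous.measurable hf']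
  refine (hG.lintegral_coord (Fin.last n) _ hf).trans ?_
  congr 1
  refine lintegral_congr fun x => ?_
  by_cases hx : x ∈ A <;> simp [hx]

/-- Every term is a multiple of the same Gaussian law, so only the weighted masses are summed, and
they add up to `exp t`. -/
lemma concentrationMeasure_eq (h : Regular P τ B) {t : ℝ} (ht : 0 < t) :
    concentrationMeasure P τ B t =
      volume.withDensity (fun x => ENNReal.ofReal (Real.exp t * heatR t x)) := by
  ext A hA
  simp_rw [ENNReal.ofReal_mul (Real.exp_pos t).le]
  rw [withDensity_apply _ hA, lintegral_const_mul' _ _ ENNReal.ofReal_ne_top,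
    concentrationMeasure, Measure.sum_apply _ hA, ← h.tsum_mul_particleLaw_univ ht.le,
    ← ENNReal.tsum_mul_right]
  refine tsum_congr fun n => ?_
  rw [h.map_last_particleLaw ht, Measure.smul_apply, Measure.smul_apply, withDensity_apply _ hA,
    smul_eq_mul, smul_eq_mul, mul_assoc]
  rfl

/-- Lifetimes are positive, so only the root is alive and it has a single enumeration, by `Fin 1`.
Its place has the Gaussian law of variance zero. -/
lemma concentrationMeasure_zero (h : Regular P τ B) :
    concentrationMeasure P τ B 0 = Measure.dirac 0 := by
  have hal : ∀ ω, alive τ 0 ω = {[]} := fun ω =>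
    alive_of_lt h.lifetime_pos le_rfl (h.lifetime_pos _ _)
  have hB : B [] 0 =ᵐ[P] fun _ => 0 := by
    have h1 : ∀ᵐ x ∂(P.map (B [] 0)), x = 0 := by
      rw [h.motion_law, gaussianReal_zero_var]
      simp [ae_dirac_eq]
    exact ae_of_ae_map (h.measurable_motion _ _).aemeasurable h1
  let e₀ : Fin 1 ↪ List Bool := ⟨fun _ => [], fun _ _ _ => Subsingleton.elim _ _⟩
  have he₀ : ∀ i, e₀ i = [] := fun _ => rfl
  have hone : particleLaw P τ B 1 0 = P.map (fun ω _ => B [] 0 ω) := by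
    ext A hA
    simp only [particleLaw, hal, Measure.smul_apply, Measure.sum_apply _ hA]
    rw [tsum_eq_single e₀]
    · have : {ω : Ω | ({[]} : Set (List Bool)) = Set.range e₀} = Set.univ := by
        refine Set.eq_univ_of_forall fun ω => ?_
        exact (Set.range_const (ι := Fin 1) (c := ([] : List Bool))).symm
      rw [this, Measure.restrict_univ]
      simp [he₀, position_nil]
    · intro e he
      have : {ω : Ω | ({[]} : Set (List Bool)) = Set.range e} = ∅ := by
        ext ω
        simp only [Set.mem_ofPred_eq, Set.mem_empty_iff_false, iff_false]
        intro hr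
        refine he (DFunLike.ext _ _ fun i => ?_)
        have : e i ∈ ({[]} : Set (List Bool)) := hr ▸ Set.mem_range_self i
        exact this
      rw [this]
      simp
  have hmany : ∀ n : ℕ, n ≠ 0 → particleLaw P τ B (n + 1) 0 = 0 := by
    intro n hn
    have : ∀ e : Fin (n + 1) ↪ List Bool,
        {ω : Ω | ({[]} : Set (List Bool)) = Set.range e} = ∅ := by
      intro e
      ext ω
      simp only [Set.mem_ofPred_eq, Set.mem_empty_iff_false, iff_false]
      intro hr
      have h1 : e 0 ∈ ({[]} : Set (List Bool)) := hr ▸ Set.mem_range_self _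
      have h2 : e (Fin.last n) ∈ ({[]} : Set (List Bool)) := hr ▸ Set.mem_range_self _
      have := e.injective (h1.trans h2.symm)
      exact hn (by simpa [Fin.ext_iff] using this.symm)
    simp only [particleLaw, hal, this]
    simp
  ext A hA
  rw [concentrationMeasure, Measure.sum_apply _ hA, tsum_eq_single 0]
  · have hm : Measurable fun (ω : Ω) (_ : Fin 1) => B [] 0 ω :=
      measurable_pi_iff.2 fun _ => h.measurable_motion _ _
    simp only [Nat.cast_zero, zero_add, one_smul, hone]
    rw [Measure.map_map (measurable_pi_apply _) hm]
    have : ((fun y : Fin 1 → ℝ => y (Fin.last 0)) ∘ fun (ω : Ω) (_ : Fin 1) => B [] 0 ω) =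
        B [] 0 := rfl
    rw [this, Measure.map_congr hB, Measure.map_const, measure_univ, one_smul]
  · intro n hn
    simp [hmany n hn]

end Regular

namespace IsParticleDensity

variable {Ω : Type*} [MeasurableSpace Ω] {P : Measure Ω} [IsProbabilityMeasure P]
  {τ : List Bool → Ω → ℝ} {B : List Bool → ℝ≥0 → Ω → ℝ} {ρ : (n : ℕ) → ℝ → (Fin n → ℝ) → ℝ}

/-- Two continuous densities of the same law agree everywhere, so an arbitrary `ρ` inherits the
pointwise marginals of the constructed density. -/
lemma integrable_and_lastMarginal_eq (hρ : IsParticleDensity P τ B ρ) (h : Regular P τ B)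
    {t : ℝ} (ht : 0 < t) (n : ℕ) (x : ℝ) :
    Integrable (fun y : Fin n → ℝ => ρ (n + 1) t (Fin.snoc (α := fun _ => ℝ) y x)) ∧
    lastMarginal ρ n t x = (particleLaw P τ B (n + 1) t Set.univ).toReal * heatR t x := by
  obtain ⟨G, hG, hlaw⟩ := h.exists_density (n + 1) ht
  have hmass : particleLaw P τ B (n + 1) t Set.univ = ∫⁻ x, G x := by
    rw [hlaw, withDensity_apply _ MeasurableSet.univ, Measure.restrict_univ]
  have hfin : ∫⁻ x, G x ≠ ∞ := hmass ▸ h.particleLaw_univ_ne_top ht.le n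
  have hc := hρ.continuous (n + 1) t (by omega) ht
  have hc' : Continuous fun y => ENNReal.ofReal (ρ (n + 1) t y) :=
    ENNReal.continuous_ofReal.comp hc
  have heq : (fun y => ENNReal.ofReal (ρ (n + 1) t y)) = G := by
    refine (hc'.ae_eq_iff_eq volume hG.continuous).1 ?_
    refine (withDensity_eq_iff_of_sigmaFinite hc'.aemeasurable hG.continuous.aemeasurable).1 ?_
    rw [← hlaw, hρ.law_eq (n + 1) t (by omega) ht]
  have hint : ∫⁻ y : Fin n → ℝ, ENNReal.ofReal (ρ (n + 1) t (Fin.snoc (α := fun _ => ℝ) y x)) =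
      particleLaw P τ B (n + 1) t Set.univ * heat t x := by
    rw [hmass, ← hG.lintegral_snoc_eq ht hfin x, ← heq]
  have hnn : ∀ y : Fin n → ℝ, 0 ≤ ρ (n + 1) t (Fin.snoc (α := fun _ => ℝ) y x) := fun y =>
    hρ.nonneg (n + 1) t (by omega) ht _
  have hsm : AEStronglyMeasurable
      (fun y : Fin n → ℝ => ρ (n + 1) t (Fin.snoc (α := fun _ => ℝ) y x)) volume :=
    (hc.comp (continuous_snoc_left x)).aestronglyMeasurable
  constructor
  · refine ⟨hsm, ?_⟩
    rw [hasFiniteIntegral_iff_ofReal (Eventually.of_forall hnn), hint, hmass]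
    exact (ENNReal.mul_ne_top hfin (heat_ne_top t x)).lt_top
  · rw [lastMarginal, integral_eq_lintegral_of_nonneg_ae (Eventually.of_forall hnn) hsm, hint,
      ENNReal.toReal_mul, heat, ENNReal.toReal_ofReal (heatR_nonneg t x)]

lemma hasSum_lastMarginal (hρ : IsParticleDensity P τ B ρ) (h : Regular P τ B)
    {t : ℝ} (ht : 0 < t) (x : ℝ) :
    HasSum (fun n : ℕ => ((n : ℝ) + 1) * lastMarginal ρ n t x) (Real.exp t * heatR t x) := by
  have hq := h.tsum_mul_particleLaw_univ ht.le
  have hs := ENNReal.hasSum_toReal (f := fun n : ℕ =>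
    ((n : ℝ≥0∞) + 1) * particleLaw P τ B (n + 1) t Set.univ)
    (by rw [hq]; exact ENNReal.ofReal_ne_top)
  rw [← ENNReal.tsum_toReal_eq fun n => ENNReal.mul_ne_top (by finiteness)
    (h.particleLaw_univ_ne_top ht.le n), hq, ENNReal.toReal_ofReal (Real.exp_pos t).le] at hs
  have he : (fun n : ℕ => ((n : ℝ) + 1) * lastMarginal ρ n t x) = fun n : ℕ =>
      (((n : ℝ≥0∞) + 1) * particleLaw P τ B (n + 1) t Set.univ).toReal * heatR t x := by
    ext n
    rw [(hρ.integrable_and_lastMarginal_eq h ht n x).2, ENNReal.toReal_mul, mul_assoc]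
    congr 1
  rw [he]
  exact hs.mul_right (heatR t x)

lemma averageConcentration_eq (hρ : IsParticleDensity P τ B ρ) (h : Regular P τ B)
    {t : ℝ} (ht : 0 < t) (x : ℝ) : averageConcentration ρ t x = Real.exp t * heatR t x :=
  (hρ.hasSum_lastMarginal h ht x).tsum_eq

end IsParticleDensity

lemma Regular.exists_isParticleDensity {Ω : Type*} [MeasurableSpace Ω] {P : Measure Ω}
    [IsProbabilityMeasure P] {τ : List Bool → Ω → ℝ} {B : List Bool → ℝ≥0 → Ω → ℝ}
    (h : Regular P τ B) : ∃ ρ, IsParticleDensity P τ B ρ := by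
  classical
  choose G hG hlaw using fun (n : ℕ) (t : ℝ) (ht : 0 < t) => h.exists_density n ht
  have hfin : ∀ n t (ht : 0 < t), 1 ≤ n → ∀ y, G n t ht y ≠ ∞ := by
    intro n t ht hn y
    obtain ⟨C, hC, hle⟩ := (hG n t ht).exists_le
    -- Here `1 ≤ n` supplies the coordinate `0`; for `n = 0` the heat kernel bounds are vacuous.
    exact ne_top_of_le_ne_top (ENNReal.mul_ne_top hC (heat_ne_top _ _)) (hle y ⟨0, hn⟩)
  refine ⟨fun n t y => if ht : 0 < t then (G n t ht y).toReal else 0, ?_, ?_, ?_⟩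
  · intro n t _ ht y
    simp [ht]
  · intro n t hn ht
    simp only [ht, dif_pos]
    exact ENNReal.continuousOn_toReal.comp_continuous (hG n t ht).continuous (hfin n t ht hn)
  · intro n t hn ht
    simp only [ht, dif_pos, ENNReal.ofReal_toReal (hfin n t ht hn _)]
    exact hlaw n t ht

lemma IsParticleDensity.congr {Ω : Type*} [MeasurableSpace Ω] {P : Measure Ω}
    {τ τ' : List Bool → Ω → ℝ} {B B' : List Bool → ℝ≥0 → Ω → ℝ}
    {ρ : (n : ℕ) → ℝ → (Fin n → ℝ) → ℝ}
    (h : ∀ᵐ ω ∂P, ∀ u, τ u ω = τ' u ω ∧ ∀ s, B u s ω = B' u s ω)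
    (hρ : IsParticleDensity P τ B ρ) : IsParticleDensity P τ' B' ρ where
  nonneg := hρ.nonneg
  continuous := hρ.continuous
  law_eq n t hn ht := by rw [← particleLaw_congr h, hρ.law_eq n t hn ht]

end

end BBM

/-! ### The theorem, read off from the closed form. -/

theorem theorem2 {Ω : Type*} [MeasurableSpace Ω] (P : Measure Ω) [IsProbabilityMeasure P]
    (τ : List Bool → Ω → ℝ) (B : List Bool → ℝ≥0 → Ω → ℝ)
    (hBBM : BBM.IsBranchingBrownianMotion P τ B) :
    -- the densities exist
    (∃ ρ : (n : ℕ) → ℝ → (Fin n → ℝ) → ℝ, BBM.IsParticleDensity P τ B ρ) ∧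
    ∀ ρ : (n : ℕ) → ℝ → (Fin n → ℝ) → ℝ, BBM.IsParticleDensity P τ B ρ →
      -- the integrals and the series in the definition of `c` converge
      (∀ t x : ℝ, 0 < t →
        (∀ n : ℕ, Integrable
          (fun y : Fin n → ℝ => ρ (n + 1) t (Fin.snoc (α := fun _ => ℝ) y x))) ∧
        Summable (fun n : ℕ => ((n : ℝ) + 1) * BBM.lastMarginal ρ n t x)) ∧
      -- `c` is a classical solution of the equation for `t > 0`
      ContinuousOn (fun z : ℝ × ℝ => BBM.averageConcentration ρ z.1 z.2)
        (Set.Ioi 0 ×ˢ Set.univ) ∧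
      (∀ t : ℝ, 0 < t → ContDiff ℝ 2 (BBM.averageConcentration ρ t)) ∧
      (∀ t x : ℝ, 0 < t →
        HasDerivAt (fun s : ℝ => BBM.averageConcentration ρ s x)
          (1 / 2 * iteratedDeriv 2 (BBM.averageConcentration ρ t) x
            + BBM.averageConcentration ρ t x) t) ∧
      -- `c(t, x) dx` is the average concentration of particles, it is `δ₀` at time `0`,
      -- and it converges weakly to `δ₀` as `t` decreases to `0`
      (∀ t : ℝ, 0 < t → BBM.concentrationMeasure P τ B t =
        volume.withDensity (fun x => ENNReal.ofReal (BBM.averageConcentration ρ t x))) ∧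
      BBM.concentrationMeasure P τ B 0 = Measure.dirac 0 ∧
      (∀ t : ℝ, 0 < t → Integrable (BBM.averageConcentration ρ t)) ∧
      (∀ f : ℝ →ᵇ ℝ, Tendsto (fun t : ℝ => ∫ x, f x * BBM.averageConcentration ρ t x)
        (𝓝[>] 0) (𝓝 (f 0))) := by
  obtain ⟨τ', B', h, hae⟩ := hBBM.exists_regular
  have hae' : ∀ᵐ ω ∂P, ∀ u, τ' u ω = τ u ω ∧ ∀ s, B' u s ω = B u s ω := by
    filter_upwards [hae] with ω hω u using ⟨(hω u).1.symm, fun s => ((hω u).2 s).symm⟩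
  obtain ⟨ρ₀, hρ₀⟩ := h.exists_isParticleDensity
  refine ⟨⟨ρ₀, hρ₀.congr hae'⟩, fun ρ hρ' => ?_⟩
  have hρ := hρ'.congr hae
  have hc : ∀ t, 0 < t → BBM.averageConcentration ρ t = fun x => Real.exp t * BBM.heatR t x :=
    fun t ht => funext fun x => hρ.averageConcentration_eq h ht x
  refine ⟨fun t x ht => ⟨fun n => (hρ.integrable_and_lastMarginal_eq h ht n x).1,
    (hρ.hasSum_lastMarginal h ht x).summable⟩, ?_, ?_, ?_, ?_, ?_, ?_, ?_⟩
  · refine ContinuousOn.congr (f := fun z : ℝ × ℝ => Real.exp z.1 * BBM.heatR z.1 z.2)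
      (ContinuousOn.mul (by fun_prop) BBM.continuousOn_heatR) fun z hz => ?_
    exact hρ.averageConcentration_eq h hz.1 z.2
  · intro t ht
    rw [hc t ht]
    exact contDiff_const.mul (BBM.contDiff_heatR t)
  · intro t x ht
    have h1 : iteratedDeriv 2 (BBM.averageConcentration ρ t) x =
        Real.exp t * ((x ^ 2 / t ^ 2 - 1 / t) * BBM.heatR t x) := by
      rw [hc t ht, iteratedDeriv_const_mul_field, BBM.iteratedDeriv_two_heatR ht]
    rw [h1, hρ.averageConcentration_eq h ht]
    -- By the product rule the exponential produces the growth term and the heat kernel the half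
    -- Laplacian. The closed form holds only for positive times, which is enough near `t`.
    refine (((Real.hasDerivAt_exp t).mul (BBM.hasDerivAt_heatR_time ht x)).congr_deriv
      (by ring)).congr_of_eventuallyEq ?_
    filter_upwards [lt_mem_nhds ht] with s hs
    exact hρ.averageConcentration_eq h hs x
  · intro t ht
    rw [BBM.concentrationMeasure_congr hae, h.concentrationMeasure_eq ht, hc t ht]
  · rw [BBM.concentrationMeasure_congr hae, h.concentrationMeasure_zero]
  · intro t ht
    rw [hc t ht]
    exact (BBM.integrable_heatR ht).const_mul _
  · intro f
    have h1 : Tendsto (fun t : ℝ => Real.exp t * ∫ x, f x * BBM.heatR t x) (𝓝[>] 0)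
        (𝓝 (1 * f 0)) := by
      refine Tendsto.mul ?_ (BBM.tendsto_integral_mul_heatR f)
      have := (Real.continuous_exp.tendsto 0).mono_left (nhdsWithin_le_nhds (s := Set.Ioi 0))
      simpa using this
    rw [one_mul] at h1
    refine h1.congr' ?_
    filter_upwards [self_mem_nhdsWithin] with t ht
    rw [← integral_const_mul, hc t ht]
    congr 1
    ext x
    ring
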